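/- **Conventions.** Extriangulated categories $(\mathcal C,\mathbb E,\mathfrak s)$ are in the sense of Nakaoka–Palu. If $A\xrightarrow{x}B\xrightarrow{y}C$ realizes some $\delta\in\mathbb E(C,A)$, the sequence is a *conflation* (with $\delta$, an $\mathbb E$-triangle), $x$ is an *inflation* and $y$ a *deflation*. An object $P$ is *projective* if every morphism $P\to C$ lifts along every deflation $B\to C$; there are *enough projectives* if each object $C$ admits a conflation $A\to P\to C$ with $P$ projective. A morphism is *compatible* if it is an isomorphism whenever it is both an inflation and a deflation. A sequence $A\xrightarrow{f}B\xrightarrow{g}C$ is *right exact* if there are a conflation $K\xrightarrow{h_2}B\xrightarrow{g}C$ and a compatible deflation $h_1:A\to K$ with $f=h_2h_1$; it is *left exact* if there are a conflation $A\xrightarrow{f}B\xrightarrow{h_1}K$ and a compatible inflation $h_2:K\to C$ with $g=h_2h_1$. A four-term sequence $A\xrightarrow{f}B\xrightarrow{g}C\xrightarrow{h}D$ is *right exact* (resp. *left exact*) if there are conflations $A\xrightarrow{f}B\xrightarrow{g_1}K$ and $K\xrightarrow{g_2}C\xrightarrow{h}D$ with $g=g_2g_1$ and $g_1$ (resp.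 $g_2$) compatible. An additive functor $F$ between extriangulated categories is *exact* if it preserves compatible morphisms and there is a natural transformation $\eta:\mathbb E(-,-)\Rightarrow\mathbb E(F-,F-)$ of functors to abelian groups such that, whenever $A\xrightarrow{x}B\xrightarrow{y}C$ realizes $\delta$, the sequence $FA\xrightarrow{Fx}FB\xrightarrow{Fy}FC$ realizes $\eta(\delta)$. It is *right exact* if it preserves compatible morphisms and right exact sequences, and there is a family assigning to each $\delta\in\mathbb E(C,A)$ an object $A'_\delta$, a compatible deflation $p_\delta:FA\to A'_\delta$ and an extension $\eta(\delta)\in\mathbb E(FC,A'_\delta)$ such that: for every realization $A\xrightarrow{f}B\xrightarrow{g}C$ of $\delta$ there is $x:A'_\delta\to FB$ with $Ff=x\,p_\delta$ and with $A'_\delta\xrightarrow{x}FB\xrightarrow{Fg}FC$ realizing $\eta(\delta)$; and for every morphism of extensions $(a,c):\delta\to\delta_1$ (that is, $a_*\delta=c^*\delta_1$) there is $a':A'_\delta\to A'_{\delta_1}$ with $a'p_\delta=p_{\delta_1}F(a)$ and $a'_*\eta(\delta)=(Fc)^*\eta(\delta_1)$. *Left exact* functors are defined dually. A *recollement* of $\mathcal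 B$ relative to extriangulated categories $\mathcal A$ and $\mathcal C$ consists of exact functors $i_*:\mathcal A\to\mathcal B$ and $j^*:\mathcal B\to\mathcal C$, right exact functors $i^*:\mathcal B\to\mathcal A$ and $j_!:\mathcal C\to\mathcal B$, and left exact functors $i^!:\mathcal B\to\mathcal A$ and $j_*:\mathcal C\to\mathcal B$ such that (R1) $(i^*,i_*,i^!)$ and $(j_!,j^*,j_*)$ are adjoint triples; (R2) the essential image of $i_*$ is $\operatorname{Ker}j^*=\{X : j^*X\cong 0\}$; (R3) $i_*,j_!,j_*$ are fully faithful; (R4) for each $X\in\mathcal B$ there is a left exact four-term sequence $i_*i^!X\to X\to j_*j^*X\to i_*A$ with $A\in\mathcal A$; (R5) for each $X\in\mathcal B$ there is a right exact four-term sequence $i_*A'\to j_!j^*X\to X\to i_*i^*X$ with $A'\in\mathcal A$; the maps between $X$ and $i_*i^!X$, $j_*j^*X$, $j_!j^*X$, $i_*i^*X$ are the adjunction (co)units. A *recollement of abelian categories* consists of six additive functors between abelian categories satisfying (R1), (R2), (R3). A full subcategory $\mathcal T\subseteq\mathcal B$ closed under isomorphisms is *cluster tilting* if (1) for every $X\in\mathcal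 B$ there are conflations $K\to T\xrightarrow{g}X$ and $X\xrightarrow{f}T'\to L$ with $g$ a right and $f$ a left $\mathcal T$-approximation of $X$; (2) $T\in\mathcal T$ if and only if $\mathbb E(T,\mathcal T)=0$; (3) $T\in\mathcal T$ if and only if $\mathbb E(\mathcal T,T)=0$. For a full subcategory $\mathcal T$ of an additive category $\mathcal B$, $\mathcal B/\mathcal T$ denotes the quotient of $\mathcal B$ by the ideal generated by the morphisms that factor through objects of $\mathcal T$, with projection $\pi_{\mathcal B}:\mathcal B\to\mathcal B/\mathcal T$. Write $i^*\mathcal T$ and $j^*\mathcal T$ for the full subcategories of objects isomorphic to some $i^*T$, respectively $j^*T$, with $T\in\mathcal T$. **Theorem.** Let $(\mathcal A,\mathcal B,\mathcal C)$ be a recollement of extriangulated categories with functors $i^*,i_*,i^!,j_!,j^*,j_*$, where $\mathcal B$ has enough projectives and $i^*$ and $i^!$ are exact. Let $\mathcal T$ be a cluster tilting subcategory of $\mathcal B$ with $j_*j^*\mathcal T\subseteq\mathcal T$ and $i_*i^*\mathcal T\subseteq\mathcal T$. Then the categories $\mathcal A/i^*\mathcal T$, $\mathcal B/\mathcal T$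 and $\mathcal C/j^*\mathcal T$ are abelian, and there is a recollement of abelian categories of $\mathcal B/\mathcal T$ relative to $\mathcal A/i^*\mathcal T$ and $\mathcal C/j^*\mathcal T$ whose six functors $\overline{i}^*,\overline{i}_*,\overline{i}^!,\overline{j}_!,\overline{j}^*,\overline{j}_*$ are induced by the original ones, that is, they commute with the projections: $\overline{i}^*\pi_{\mathcal B}=\pi_{\mathcal A}i^*$, $\overline{i}_*\pi_{\mathcal A}=\pi_{\mathcal B}i_*$, $\overline{i}^!\pi_{\mathcal B}=\pi_{\mathcal A}i^!$, $\overline{j}_!\pi_{\mathcal C}=\pi_{\mathcal B}j_!$, $\overline{j}^*\pi_{\mathcal B}=\pi_{\mathcal C}j^*$, $\overline{j}_*\pi_{\mathcal C}=\pi_{\mathcal B}j_*$. -/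

import Mathlib

open CategoryTheory CategoryTheory.Limits Opposite

universe w₁ w₂ w₃ w v₁ v₂ v₃ v u₁ u₂ u₃ u

namespace Extri

/-! ### Extriangulated categories (Nakaoka–Palu) -/

section Bifunctor

variable {C : Type u} [Category.{v} C] (E : Cᵒᵖ ⥤ C ⥤ AddCommGrpCat.{w})

/-- The abelian group `𝔼(Z, A)` of extensions of `Z` by `A`. -/
abbrev Ext (Z A : C) : Type w := (E.obj (op Z)).obj A

/-- `a_* δ`, for `a : A ⟶ A'` and `δ ∈ 𝔼(Z, A)`. -/
def push {Z A A' : C} (a : A ⟶ A') (δ : Ext E Z A) : Ext E Z A' :=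
  ((E.obj (op Z)).map a).hom δ

/-- `c^* δ`, for `c : Z' ⟶ Z` and `δ ∈ 𝔼(Z, A)`. -/
def pull {Z Z' A : C} (c : Z' ⟶ Z) (δ : Ext E Z A) : Ext E Z' A :=
  ((E.map c.op).app A).hom δ

variable [Preadditive C] [HasZeroObject C] [HasBinaryBiproducts C]

/-- The direct sum `δ ⊕ δ' ∈ 𝔼(Z ⊕ Z', A ⊕ A')`: the element with components `(δ, 0, 0, δ')`. -/
noncomputable def extSum {Z A Z' A' : C} (δ : Ext E Z A) (δ' : Ext E Z' A') :
    Ext E (Z ⊞ Z') (A ⊞ A') :=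
  pull E biprod.fst (push E biprod.inl δ) + pull E biprod.snd (push E biprod.inr δ')

end Bifunctor

/-- An extriangulated structure `(𝔼, 𝔰)` on an additive category. The realization `𝔰` is given by
the predicate `Realizes x y δ`, which says that the sequence `A --x--> B --y--> Z` belongs to the
equivalence class `𝔰(δ)`, i.e. that `A --x--> B --y--> Z --δ-->` is an `𝔼`-triangle. -/
structure ExtriangulatedStructure (C : Type u) [Category.{v} C] [Preadditive C]
    [HasZeroObject C] [HasBinaryBiproducts C] where
  /-- The bifunctor `𝔼`. -/
  E : Cᵒᵖ ⥤ C ⥤ AddCommGrpCat.{w}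
  additive_right : ∀ Z : Cᵒᵖ, (E.obj Z).Additive
  additive_left : ∀ A : C, (E.flip.obj A).Additive
  /-- The sequence `A --x--> B --y--> Z` lies in the class `𝔰(δ)`. -/
  Realizes : ∀ {A B Z : C}, (A ⟶ B) → (B ⟶ Z) → Ext E Z A → Prop
  /-- `𝔰(δ)` is nonempty ... -/
  exists_realizes : ∀ {Z A : C} (δ : Ext E Z A), ∃ (B : C) (x : A ⟶ B) (y : B ⟶ Z), Realizes x y δ
  /-- ... and is one equivalence class of sequences from `A` to `Z`. -/
  realizes_iff : ∀ {A B B' Z : C} {x : A ⟶ B} {y : B ⟶ Z} {δ : Ext E Z A}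
    (x' : A ⟶ B') (y' : B' ⟶ Z), Realizes x y δ →
    (Realizes x' y' δ ↔ ∃ e : B ≅ B', x ≫ e.hom = x' ∧ e.hom ≫ y' = y)
  /-- `𝔰` is a realization: every morphism of extensions is realized by a morphism of sequences. -/
  exists_middle : ∀ {A B Z A' B' Z' : C} {x : A ⟶ B} {y : B ⟶ Z} {δ : Ext E Z A}
    {x' : A' ⟶ B'} {y' : B' ⟶ Z'} {δ' : Ext E Z' A'}, Realizes x y δ → Realizes x' y' δ' →
    ∀ (a : A ⟶ A') (c : Z ⟶ Z'), push E a δ = pull E c δ' →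
      ∃ b : B ⟶ B', x ≫ b = a ≫ x' ∧ y ≫ c = b ≫ y'
  /-- `𝔰` is additive. -/
  realizes_zero : ∀ A Z : C,
    Realizes (biprod.inl : A ⟶ A ⊞ Z) (biprod.snd : A ⊞ Z ⟶ Z) (0 : Ext E Z A)
  realizes_sum : ∀ {A B Z A' B' Z' : C} {x : A ⟶ B} {y : B ⟶ Z} {δ : Ext E Z A}
    {x' : A' ⟶ B'} {y' : B' ⟶ Z'} {δ' : Ext E Z' A'}, Realizes x y δ → Realizes x' y' δ' →
    Realizes (biprod.map x x') (biprod.map y y') (extSum E δ δ')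
  /-- (ET3) -/
  et3 : ∀ {A B Z A' B' Z' : C} {x : A ⟶ B} {y : B ⟶ Z} {δ : Ext E Z A}
    {x' : A' ⟶ B'} {y' : B' ⟶ Z'} {δ' : Ext E Z' A'}, Realizes x y δ → Realizes x' y' δ' →
    ∀ (a : A ⟶ A') (b : B ⟶ B'), x ≫ b = a ≫ x' →
      ∃ c : Z ⟶ Z', y ≫ c = b ≫ y' ∧ push E a δ = pull E c δ'
  /-- (ET3)ᵒᵖ -/
  et3op : ∀ {A B Z A' B' Z' : C} {x : A ⟶ B} {y : B ⟶ Z} {δ : Ext E Z A}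
    {x' : A' ⟶ B'} {y' : B' ⟶ Z'} {δ' : Ext E Z' A'}, Realizes x y δ → Realizes x' y' δ' →
    ∀ (b : B ⟶ B') (c : Z ⟶ Z'), y ≫ c = b ≫ y' →
      ∃ a : A ⟶ A', x ≫ b = a ≫ x' ∧ push E a δ = pull E c δ'
  /-- (ET4) -/
  et4 : ∀ {A B D Z F : C} {f : A ⟶ B} {f' : B ⟶ D} {g : B ⟶ Z} {g' : Z ⟶ F}
    {δ : Ext E D A} {δ' : Ext E F B}, Realizes f f' δ → Realizes g g' δ' →
    ∃ (G : C) (d : D ⟶ G) (e : G ⟶ F) (h' : Z ⟶ G) (δ'' : Ext E G A),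
      f' ≫ d = g ≫ h' ∧ h' ≫ e = g' ∧ Realizes (f ≫ g) h' δ'' ∧
      Realizes d e (push E f' δ') ∧ pull E d δ'' = δ ∧ push E f δ'' = pull E e δ'
  /-- (ET4)ᵒᵖ -/
  et4op : ∀ {D A B F Z : C} {f' : D ⟶ A} {f : A ⟶ B} {g' : F ⟶ B} {g : B ⟶ Z}
    {δ : Ext E B D} {δ' : Ext E Z F}, Realizes f' f δ → Realizes g' g δ' →
    ∃ (G : C) (d : D ⟶ G) (e : G ⟶ F) (h' : G ⟶ A) (δ'' : Ext E Z G),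
      d ≫ h' = f' ∧ e ≫ g' = h' ≫ f ∧ Realizes h' (f ≫ g) δ'' ∧
      Realizes d e (pull E g' δ) ∧ push E e δ'' = δ' ∧ push E d δ = pull E g δ''

namespace ExtriangulatedStructure

variable {C : Type u} [Category.{v} C] [Preadditive C] [HasZeroObject C] [HasBinaryBiproducts C]
  (S : ExtriangulatedStructure.{w} C)

/-- `A --x--> B --y--> Z` is a conflation. -/
def IsConflation {A B Z : C} (x : A ⟶ B) (y : B ⟶ Z) : Prop := ∃ δ, S.Realizes x y δ

def IsInflation {A B : C} (x : A ⟶ B) : Prop := ∃ (Z : C) (y : B ⟶ Z), S.IsConflation x y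

def IsDeflation {B Z : C} (y : B ⟶ Z) : Prop := ∃ (A : C) (x : A ⟶ B), S.IsConflation x y

/-- If `f` is both an inflation and a deflation, then it is an isomorphism. -/
def IsCompatible {A B : C} (f : A ⟶ B) : Prop := S.IsInflation f → S.IsDeflation f → IsIso f

def IsProjective (P : C) : Prop :=
  ∀ {A B Z : C} (x : A ⟶ B) (y : B ⟶ Z), S.IsConflation x y →
    ∀ c : P ⟶ Z, ∃ b : P ⟶ B, b ≫ y = c

def HasEnoughProjectives : Prop :=
  ∀ Z : C, ∃ (A P : C) (x : A ⟶ P) (y : P ⟶ Z), S.IsConflation x y ∧ S.IsProjective P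

/-- Right exactness of a sequence `A --f--> B --g--> Z`. -/
def IsRightExactSeq {A B Z : C} (f : A ⟶ B) (g : B ⟶ Z) : Prop :=
  ∃ (K : C) (h₁ : A ⟶ K) (h₂ : K ⟶ B),
    S.IsConflation h₂ g ∧ S.IsDeflation h₁ ∧ S.IsCompatible h₁ ∧ h₁ ≫ h₂ = f

/-- Left exactness of a sequence `A --f--> B --g--> Z`. -/
def IsLeftExactSeq {A B Z : C} (f : A ⟶ B) (g : B ⟶ Z) : Prop :=
  ∃ (K : C) (h₁ : B ⟶ K) (h₂ : K ⟶ Z),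
    S.IsConflation f h₁ ∧ S.IsInflation h₂ ∧ S.IsCompatible h₂ ∧ h₁ ≫ h₂ = g

/-- A right exact four-term `𝔼`-triangle sequence. -/
def IsRightExactFour {A B Z D : C} (f : A ⟶ B) (g : B ⟶ Z) (h : Z ⟶ D) : Prop :=
  ∃ (K : C) (g₁ : B ⟶ K) (g₂ : K ⟶ Z),
    S.IsConflation f g₁ ∧ S.IsConflation g₂ h ∧ g₁ ≫ g₂ = g ∧ S.IsCompatible g₁

/-- A left exact four-term `𝔼`-triangle sequence. -/
def IsLeftExactFour {A B Z D : C} (f : A ⟶ B) (g : B ⟶ Z) (h : Z ⟶ D) : Prop :=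
  ∃ (K : C) (g₁ : B ⟶ K) (g₂ : K ⟶ Z),
    S.IsConflation f g₁ ∧ S.IsConflation g₂ h ∧ g₁ ≫ g₂ = g ∧ S.IsCompatible g₂

/-- `g : T ⟶ X` is a right `𝒯`-approximation of `X`. -/
def IsRightApprox (𝒯 : ObjectProperty C) {T X : C} (g : T ⟶ X) : Prop :=
  𝒯 T ∧ ∀ (T' : C), 𝒯 T' → ∀ h : T' ⟶ X, ∃ k : T' ⟶ T, k ≫ g = h

/-- `f : X ⟶ T` is a left `𝒯`-approximation of `X`. -/
def IsLeftApprox (𝒯 : ObjectProperty C) {X T : C} (f : X ⟶ T) : Prop :=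
  𝒯 T ∧ ∀ (T' : C), 𝒯 T' → ∀ h : X ⟶ T', ∃ k : T ⟶ T', f ≫ k = h

def IsStronglyContravariantlyFinite (𝒯 : ObjectProperty C) : Prop :=
  ∀ X : C, ∃ (K T : C) (k : K ⟶ T) (g : T ⟶ X), S.IsConflation k g ∧ IsRightApprox 𝒯 g

def IsStronglyCovariantlyFinite (𝒯 : ObjectProperty C) : Prop :=
  ∀ X : C, ∃ (T L : C) (f : X ⟶ T) (l : T ⟶ L), S.IsConflation f l ∧ IsLeftApprox 𝒯 f

/-- Cluster tilting subcategories; a full subcategory closed under isomorphisms is given by a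
property of objects that is closed under isomorphisms. -/
structure IsClusterTilting (𝒯 : ObjectProperty C) : Prop where
  closedUnderIso : 𝒯.IsClosedUnderIsomorphisms
  contravariantlyFinite : S.IsStronglyContravariantlyFinite 𝒯
  covariantlyFinite : S.IsStronglyCovariantlyFinite 𝒯
  mem_iff_left : ∀ T : C, 𝒯 T ↔ ∀ T' : C, 𝒯 T' → ∀ δ : Ext S.E T T', δ = 0
  mem_iff_right : ∀ T : C, 𝒯 T ↔ ∀ T' : C, 𝒯 T' → ∀ δ : Ext S.E T' T, δ = 0

end ExtriangulatedStructure

/-! ### Exact functors -/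

section Functors

variable {A : Type u₁} [Category.{v₁} A] [Preadditive A] [HasZeroObject A] [HasBinaryBiproducts A]
  {B : Type u₂} [Category.{v₂} B] [Preadditive B] [HasZeroObject B] [HasBinaryBiproducts B]
  (S : ExtriangulatedStructure.{w₁} A) (S' : ExtriangulatedStructure.{w₂} B) (F : A ⥤ B)

/-- Exact functors: `η` is a natural transformation `𝔼_A(-, -) ⟶ 𝔼_B(F -, F -)` of functors to
abelian groups that is compatible with the realizations. -/
structure IsExactFunctor : Prop where
  additive : F.Additive
  map_compatible : ∀ {X Y : A} (f : X ⟶ Y), S.IsCompatible f → S'.IsCompatible (F.map f)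
  exists_nat : ∃ η : ∀ Z X : A, Ext S.E Z X →+ Ext S'.E (F.obj Z) (F.obj X),
    (∀ {Z X X' : A} (a : X ⟶ X') (δ : Ext S.E Z X),
      η Z X' (push S.E a δ) = push S'.E (F.map a) (η Z X δ)) ∧
    (∀ {Z Z' X : A} (c : Z' ⟶ Z) (δ : Ext S.E Z X),
      η Z' X (pull S.E c δ) = pull S'.E (F.map c) (η Z X δ)) ∧
    ∀ {X Y Z : A} (x : X ⟶ Y) (y : Y ⟶ Z) (δ : Ext S.E Z X), S.Realizes x y δ →
      S'.Realizes (F.map x) (F.map y) (η Z X δ)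

/-- The natural family `η` in the definition of a right exact functor. For an extension `δ` of `Z`
by `X`, realized by `X --f--> Y --g--> Z`, the object `obj δ` (which depends on `δ`) comes with a
compatible deflation `p δ : F X ⟶ obj δ` and an extension `η δ` of `F Z` by `obj δ` realized by
some `obj δ --x--> F Y --F g--> F Z` with `F f = x ∘ p δ`. Naturality is with respect to morphisms
of extensions `(a, c) : δ ⟶ δ'`. -/
structure RightExactComparison where
  obj : ∀ {Z X : A}, Ext S.E Z X → B
  p : ∀ {Z X : A} (δ : Ext S.E Z X), F.obj X ⟶ obj δ
  p_deflation : ∀ {Z X : A} (δ : Ext S.E Z X), S'.IsDeflation (p δ)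
  p_compatible : ∀ {Z X : A} (δ : Ext S.E Z X), S'.IsCompatible (p δ)
  η : ∀ {Z X : A} (δ : Ext S.E Z X), Ext S'.E (F.obj Z) (obj δ)
  realizes : ∀ {X Y Z : A} (f : X ⟶ Y) (g : Y ⟶ Z) (δ : Ext S.E Z X), S.Realizes f g δ →
    ∃ x : obj δ ⟶ F.obj Y, p δ ≫ x = F.map f ∧ S'.Realizes x (F.map g) (η δ)
  naturality : ∀ {Z X Z' X' : A} (δ : Ext S.E Z X) (δ' : Ext S.E Z' X') (a : X ⟶ X')
    (c : Z ⟶ Z'), push S.E a δ = pull S.E c δ' →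
    ∃ a' : obj δ ⟶ obj δ', p δ ≫ a' = F.map a ≫ p δ' ∧
      push S'.E a' (η δ) = pull S'.E (F.map c) (η δ')

structure IsRightExactFunctor : Prop where
  additive : F.Additive
  map_compatible : ∀ {X Y : A} (f : X ⟶ Y), S.IsCompatible f → S'.IsCompatible (F.map f)
  map_rightExact : ∀ {X Y Z : A} (f : X ⟶ Y) (g : Y ⟶ Z),
    S.IsRightExactSeq f g → S'.IsRightExactSeq (F.map f) (F.map g)
  exists_comparison : Nonempty (RightExactComparison S S' F)

/-- The natural family `η` in the definition of a left exact functor, dual to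
`RightExactComparison`. -/
structure LeftExactComparison where
  obj : ∀ {Z X : A}, Ext S.E Z X → B
  q : ∀ {Z X : A} (δ : Ext S.E Z X), obj δ ⟶ F.obj Z
  q_inflation : ∀ {Z X : A} (δ : Ext S.E Z X), S'.IsInflation (q δ)
  q_compatible : ∀ {Z X : A} (δ : Ext S.E Z X), S'.IsCompatible (q δ)
  η : ∀ {Z X : A} (δ : Ext S.E Z X), Ext S'.E (obj δ) (F.obj X)
  realizes : ∀ {X Y Z : A} (f : X ⟶ Y) (g : Y ⟶ Z) (δ : Ext S.E Z X), S.Realizes f g δ →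
    ∃ y : F.obj Y ⟶ obj δ, y ≫ q δ = F.map g ∧ S'.Realizes (F.map f) y (η δ)
  naturality : ∀ {Z X Z' X' : A} (δ : Ext S.E Z X) (δ' : Ext S.E Z' X') (a : X ⟶ X')
    (c : Z ⟶ Z'), push S.E a δ = pull S.E c δ' →
    ∃ c' : obj δ ⟶ obj δ', c' ≫ q δ' = q δ ≫ F.map c ∧
      push S'.E (F.map a) (η δ) = pull S'.E c' (η δ')

structure IsLeftExactFunctor : Prop where
  additive : F.Additive
  map_compatible : ∀ {X Y : A} (f : X ⟶ Y), S.IsCompatible f → S'.IsCompatible (F.map f)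
  map_leftExact : ∀ {X Y Z : A} (f : X ⟶ Y) (g : Y ⟶ Z),
    S.IsLeftExactSeq f g → S'.IsLeftExactSeq (F.map f) (F.map g)
  exists_comparison : Nonempty (LeftExactComparison S S' F)

end Functors

/-! ### Recollements -/

/-- A recollement of the extriangulated category `(B, SB)` relative to `(A, SA)` and `(C, SC)`. -/
structure Recollement
    {A : Type u₁} [Category.{v₁} A] [Preadditive A] [HasZeroObject A] [HasBinaryBiproducts A]
    {B : Type u₂} [Category.{v₂} B] [Preadditive B] [HasZeroObject B] [HasBinaryBiproducts B]
    {C : Type u₃} [Category.{v₃} C] [Preadditive C] [HasZeroObject C] [HasBinaryBiproducts C]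
    (SA : ExtriangulatedStructure.{w₁} A) (SB : ExtriangulatedStructure.{w₂} B)
    (SC : ExtriangulatedStructure.{w₃} C) where
  /-- `i^*` -/
  iUpperStar : B ⥤ A
  /-- `i_*` -/
  iLowerStar : A ⥤ B
  /-- `i^!` -/
  iUpperShriek : B ⥤ A
  /-- `j_!` -/
  jLowerShriek : C ⥤ B
  /-- `j^*` -/
  jUpperStar : B ⥤ C
  /-- `j_*` -/
  jLowerStar : C ⥤ B
  iLowerStar_exact : IsExactFunctor SA SB iLowerStar
  jUpperStar_exact : IsExactFunctor SB SC jUpperStar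
  iUpperStar_rightExact : IsRightExactFunctor SB SA iUpperStar
  jLowerShriek_rightExact : IsRightExactFunctor SC SB jLowerShriek
  iUpperShriek_leftExact : IsLeftExactFunctor SB SA iUpperShriek
  jLowerStar_leftExact : IsLeftExactFunctor SC SB jLowerStar
  /-- (R1) -/
  adjStarI : iUpperStar ⊣ iLowerStar
  adjShriekI : iLowerStar ⊣ iUpperShriek
  adjShriekJ : jLowerShriek ⊣ jUpperStar
  adjStarJ : jUpperStar ⊣ jLowerStar
  /-- (R2) -/
  essImage_iff : ∀ X : B, iLowerStar.essImage X ↔ IsZero (jUpperStar.obj X)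
  /-- (R3) -/
  iLowerStar_full : iLowerStar.Full
  iLowerStar_faithful : iLowerStar.Faithful
  jLowerShriek_full : jLowerShriek.Full
  jLowerShriek_faithful : jLowerShriek.Faithful
  jLowerStar_full : jLowerStar.Full
  jLowerStar_faithful : jLowerStar.Faithful
  /-- (R4) -/
  exists_leftExactFour : ∀ X : B,
    ∃ (A₀ : A) (h : jLowerStar.obj (jUpperStar.obj X) ⟶ iLowerStar.obj A₀),
      SB.IsLeftExactFour (adjShriekI.counit.app X) (adjStarJ.unit.app X) h
  /-- (R5) -/
  exists_rightExactFour : ∀ X : B,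
    ∃ (A₀ : A) (h : iLowerStar.obj A₀ ⟶ jLowerShriek.obj (jUpperStar.obj X)),
      SB.IsRightExactFour h (adjShriekJ.counit.app X) (adjStarI.unit.app X)

/-- The category is abelian, with the given preadditive structure. -/
def IsAbelianCategory (D : Type u) [Category.{v} D] [inst : Preadditive D] : Prop :=
  ∃ h : Abelian D, h.toPreadditive = inst

/-- A recollement of abelian categories. -/
structure AbelianRecollement (A : Type u₁) [Category.{v₁} A] [Preadditive A]
    (B : Type u₂) [Category.{v₂} B] [Preadditive B]
    (C : Type u₃) [Category.{v₃} C] [Preadditive C] where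
  abelianA : IsAbelianCategory A
  abelianB : IsAbelianCategory B
  abelianC : IsAbelianCategory C
  /-- `i^*` -/
  iUpperStar : B ⥤ A
  /-- `i_*` -/
  iLowerStar : A ⥤ B
  /-- `i^!` -/
  iUpperShriek : B ⥤ A
  /-- `j_!` -/
  jLowerShriek : C ⥤ B
  /-- `j^*` -/
  jUpperStar : B ⥤ C
  /-- `j_*` -/
  jLowerStar : C ⥤ B
  iUpperStar_additive : iUpperStar.Additive
  iLowerStar_additive : iLowerStar.Additive
  iUpperShriek_additive : iUpperShriek.Additive
  jLowerShriek_additive : jLowerShriek.Additive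
  jUpperStar_additive : jUpperStar.Additive
  jLowerStar_additive : jLowerStar.Additive
  adjStarI : iUpperStar ⊣ iLowerStar
  adjShriekI : iLowerStar ⊣ iUpperShriek
  adjShriekJ : jLowerShriek ⊣ jUpperStar
  adjStarJ : jUpperStar ⊣ jLowerStar
  iLowerStar_full : iLowerStar.Full
  iLowerStar_faithful : iLowerStar.Faithful
  jLowerShriek_full : jLowerShriek.Full
  jLowerShriek_faithful : jLowerShriek.Faithful
  jLowerStar_full : jLowerStar.Full
  jLowerStar_faithful : jLowerStar.Faithful
  essImage_iff : ∀ X : B, iLowerStar.essImage X ↔ IsZero (jUpperStar.obj X)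

/-! ### Ideal quotients of additive categories -/

section Quotient

variable {C : Type u} [Category.{v} C] [Preadditive C]

/-- The morphisms of the ideal `[𝒯]`: sums of morphisms that factor through an object of `𝒯`. (If
`𝒯` contains a zero object and is closed under finite direct sums, then one summand suffices.) -/
def idealOf (𝒯 : ObjectProperty C) (X Y : C) : AddSubgroup (X ⟶ Y) :=
  AddSubgroup.closure {f | ∃ (T : C) (a : X ⟶ T) (b : T ⟶ Y), 𝒯 T ∧ a ≫ b = f}

/-- Congruence modulo the ideal `[𝒯]`. -/
def idealRel (𝒯 : ObjectProperty C) : HomRel C := fun X Y f g => f - g ∈ idealOf 𝒯 X Y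

theorem comp_mem_idealOf (𝒯 : ObjectProperty C) {X Y Z : C} (f : X ⟶ Y) {g : Y ⟶ Z}
    (hg : g ∈ idealOf 𝒯 Y Z) : f ≫ g ∈ idealOf 𝒯 X Z := by
  induction hg using AddSubgroup.closure_induction with
  | mem g h =>
    obtain ⟨T, a, b, hT, rfl⟩ := h
    exact AddSubgroup.subset_closure ⟨T, f ≫ a, b, hT, by simp⟩
  | zero => simp
  | add a b _ _ ha hb => simpa using add_mem ha hb
  | neg a _ ha => simpa using ha

theorem mem_idealOf_comp (𝒯 : ObjectProperty C) {X Y Z : C} {f : X ⟶ Y} (g : Y ⟶ Z)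
    (hf : f ∈ idealOf 𝒯 X Y) : f ≫ g ∈ idealOf 𝒯 X Z := by
  induction hf using AddSubgroup.closure_induction with
  | mem f h =>
    obtain ⟨T, a, b, hT, rfl⟩ := h
    exact AddSubgroup.subset_closure ⟨T, a, b ≫ g, hT, by simp⟩
  | zero => simp
  | add a b _ _ ha hb => simpa using add_mem ha hb
  | neg a _ ha => simpa using ha

instance (𝒯 : ObjectProperty C) : Congruence (idealRel 𝒯) where
  equivalence :=
    { refl := fun f => by simp [idealRel]
      symm := fun {f g} h => by
        have := neg_mem h
        simpa [idealRel] using this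
      trans := fun {f g k} h h' => by
        have := add_mem h h'
        simpa [idealRel] using this }
  comp_left := fun f g g' h => by
    have := comp_mem_idealOf 𝒯 f h
    simpa [idealRel] using this
  comp_right := fun g h => by
    have := mem_idealOf_comp 𝒯 g h
    simpa [idealRel] using this

/-- The ideal quotient `C/𝒯`. -/
abbrev IdealQuotient (𝒯 : ObjectProperty C) : Type u := CategoryTheory.Quotient (idealRel 𝒯)

/-- The projection functor `π : C ⥤ C/𝒯`. -/
abbrev proj (𝒯 : ObjectProperty C) : C ⥤ IdealQuotient 𝒯 :=
  CategoryTheory.Quotient.functor (idealRel 𝒯)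

instance (𝒯 : ObjectProperty C) : Preadditive (IdealQuotient 𝒯) :=
  CategoryTheory.Quotient.preadditive (idealRel 𝒯) (fun X Y f₁ f₂ g₁ g₂ h h' => by
    have := add_mem h h'
    simpa [idealRel, add_sub_add_comm] using this)

end Quotient

end Extri

namespace Extri

/-! ### Functoriality of `𝔼`. -/

section Bifunctor

variable {C : Type u} [Category.{v} C] (E : Cᵒᵖ ⥤ C ⥤ AddCommGrpCat.{w})

/-! The key fact about a cluster tilting subcategory `𝒯` is that extensions detect its ideal: a
morphism lies in `[𝒯]` exactly when it acts as zero on `𝔼(𝒯, -)`, equivalently on `𝔼(-, 𝒯)`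
(`mem_idealOf_iff_push`, `mem_idealOf_iff_pull`). Work modulo `[𝒯]` thus becomes diagram chasing in
the long exact sequences of an extriangulated category. Adding a right `𝒯`-approximation of `Y`
turns `f : X ⟶ Y` into a deflation `X ⊞ T ⟶ Y`, whose first term is a kernel of `f` modulo `[𝒯]`.
Cokernels are dual, and the same chases show that monos and epis are normal. Hence every cluster
tilting quotient is abelian (`isAbelianCategory`).

It remains to transport `𝒯`. Exactness of `i^!` and `i^*` shortens (R4) and (R5) to conflations `i_*
i^! X ⟶ X ⟶ j_* j^* X` and `j_! j^* X ⟶ X ⟶ i_* i^* X`, and makes `j_*` preserve conflations.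
Vanishing of `𝔼` then passes across the adjunctions, so `i^*𝒯` and `j^*𝒯` are cluster tilting and
all six functors respect the three subcategories. Additivity, adjunctions and full faithfulness
descend formally to the quotients.

The one axiom that is not formal is that the kernel of the induced `j^*` is the image of the induced
`i_*`. If `j^* X` lies in `j^*𝒯`, then both `j_! j^* X` and `j_* j^* X` lie in `𝒯`, and the two
conflations make the unit `X ⟶ i_* i^* X` monic and the counit `i_* i^! X ⟶ X` epic modulo `[𝒯]`.
Naturality makes the unit epic too, and an abelian category is balanced (`isIso_proj_map_unit`). -/

@[simp]
theorem push_id {Z A : C} (δ : Ext E Z A) : push E (𝟙 A) δ = δ := by simp [push]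

@[simp]
theorem pull_id {Z A : C} (δ : Ext E Z A) : pull E (𝟙 Z) δ = δ := by simp [pull]

theorem push_comp {Z A A' A'' : C} (a : A ⟶ A') (a' : A' ⟶ A'') (δ : Ext E Z A) :
    push E (a ≫ a') δ = push E a' (push E a δ) := by simp [push]

theorem pull_comp {Z Z' Z'' A : C} (c : Z' ⟶ Z) (c' : Z'' ⟶ Z') (δ : Ext E Z A) :
    pull E (c' ≫ c) δ = pull E c' (pull E c δ) := by simp [pull]

theorem push_pull {Z Z' A A' : C} (a : A ⟶ A') (c : Z' ⟶ Z) (δ : Ext E Z A) :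
    push E a (pull E c δ) = pull E c (push E a δ) := by
  simp [push, pull]

@[simp]
theorem push_map_zero {Z A A' : C} (a : A ⟶ A') : push E a (0 : Ext E Z A) = 0 := by simp [push]

@[simp]
theorem pull_map_zero {Z Z' A : C} (c : Z' ⟶ Z) : pull E c (0 : Ext E Z A) = 0 := by simp [pull]

end Bifunctor

/-! ### Additivity and long exact sequences. -/

namespace ExtriangulatedStructure

variable {C : Type u} [Category.{v} C] [Preadditive C] [HasZeroObject C] [HasBinaryBiproducts C]
  (S : ExtriangulatedStructure.{w} C)

theorem push_add {Z A A' : C} (a a' : A ⟶ A') (δ : Ext S.E Z A) :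
    push S.E (a + a') δ = push S.E a δ + push S.E a' δ := by
  have := S.additive_right (op Z)
  simp [push, Functor.map_add]

theorem push_neg {Z A A' : C} (a : A ⟶ A') (δ : Ext S.E Z A) :
    push S.E (-a) δ = -push S.E a δ := by
  have := S.additive_right (op Z)
  simp [push, Functor.map_neg]

theorem push_sub {Z A A' : C} (a a' : A ⟶ A') (δ : Ext S.E Z A) :
    push S.E (a - a') δ = push S.E a δ - push S.E a' δ := by
  rw [sub_eq_add_neg, push_add, push_neg, sub_eq_add_neg]

theorem push_zero {Z A A' : C} (δ : Ext S.E Z A) : push S.E (0 : A ⟶ A') δ = 0 := by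
  simpa using S.push_sub (0 : A ⟶ A') 0 δ

theorem pull_add {Z Z' A : C} (c c' : Z' ⟶ Z) (δ : Ext S.E Z A) :
    pull S.E (c + c') δ = pull S.E c δ + pull S.E c' δ := by
  have := S.additive_left A
  have := congrArg (fun f => f.hom δ) ((S.E.flip.obj A).map_add (f := c.op) (g := c'.op))
  simpa [pull] using this

theorem pull_neg {Z Z' A : C} (c : Z' ⟶ Z) (δ : Ext S.E Z A) :
    pull S.E (-c) δ = -pull S.E c δ := by
  have := S.additive_left A
  have := congrArg (fun f => f.hom δ) ((S.E.flip.obj A).map_neg (f := c.op))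
  simpa [pull] using this

theorem pull_sub {Z Z' A : C} (c c' : Z' ⟶ Z) (δ : Ext S.E Z A) :
    pull S.E (c - c') δ = pull S.E c δ - pull S.E c' δ := by
  rw [sub_eq_add_neg, pull_add, pull_neg, sub_eq_add_neg]

theorem pull_zero {Z Z' A : C} (δ : Ext S.E Z A) : pull S.E (0 : Z' ⟶ Z) δ = 0 := by
  simpa using S.pull_sub (0 : Z' ⟶ Z) 0 δ

theorem ext_eq_zero_of_isZero_right {Z A : C} (hA : IsZero A) (δ : Ext S.E Z A) : δ = 0 := by
  rw [← push_id S.E δ, hA.eq_of_src (𝟙 A) 0, push_zero]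

theorem ext_eq_zero_of_isZero_left {Z A : C} (hZ : IsZero Z) (δ : Ext S.E Z A) : δ = 0 := by
  rw [← pull_id S.E δ, hZ.eq_of_src (𝟙 Z) 0, pull_zero]

/-- The trivial `𝔼`-triangle `A = A ⟶ Z` with `Z` a zero object. -/
theorem realizes_id_zero (A : C) {Z : C} (hZ : IsZero Z) :
    S.Realizes (𝟙 A) (0 : A ⟶ Z) 0 := by
  refine (S.realizes_iff _ _ (S.realizes_zero A Z)).2 ⟨⟨biprod.fst, biprod.inl, ?_, by simp⟩,
    by simp, hZ.eq_of_tgt _ _⟩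
  ext
  · simp
  · simp
  · exact hZ.eq_of_src _ _
  · exact hZ.eq_of_src _ _

/-- The trivial `𝔼`-triangle `A ⟶ Z = Z` with `A` a zero object. -/
theorem realizes_zero_id {A : C} (hA : IsZero A) (Z : C) :
    S.Realizes (0 : A ⟶ Z) (𝟙 Z) 0 := by
  refine (S.realizes_iff _ _ (S.realizes_zero A Z)).2 ⟨⟨biprod.snd, biprod.inr, ?_, by simp⟩,
    by simp, by simp⟩
  ext
  · exact hA.eq_of_src _ _
  · exact hA.eq_of_src _ _
  · simp
  · simp

variable {S}

section Exactness

variable {A B Z : C} {x : A ⟶ B} {y : B ⟶ Z} {δ : Ext S.E Z A}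

/-- By (ET3) the trivial triangle `A = A ⟶ 0` maps to the given one, so `x ≫ y` factors through
zero. Comparison with trivial or split triangles also gives the Hom-exactness statements below. -/
theorem Realizes.comp_eq_zero (h : S.Realizes x y δ) : x ≫ y = 0 := by
  obtain ⟨c, hc, -⟩ := S.et3 (S.realizes_id_zero A (isZero_zero C)) h (𝟙 A) x (by simp)
  rw [← hc, zero_comp]

theorem Realizes.push_eq_zero (h : S.Realizes x y δ) : push S.E x δ = 0 := by
  obtain ⟨c, -, hc⟩ := S.et3 h (S.realizes_id_zero B (isZero_zero C)) x (𝟙 B) (by simp)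
  rw [hc, pull_map_zero]

theorem Realizes.pull_eq_zero (h : S.Realizes x y δ) : pull S.E y δ = 0 := by
  obtain ⟨a, -, ha⟩ := S.et3op (S.realizes_zero_id (isZero_zero C) B) h (𝟙 B) y (by simp)
  rw [← ha, push_map_zero]

/-- `Hom(W, A) ⟶ Hom(W, B) ⟶ Hom(W, Z)` is exact. -/
theorem Realizes.exists_comp_left (h : S.Realizes x y δ) {W : C} (t : W ⟶ B) (ht : t ≫ y = 0) :
    ∃ s : W ⟶ A, s ≫ x = t := by
  obtain ⟨a, ha, -⟩ := S.et3op (S.realizes_id_zero W (isZero_zero C)) h t 0 (by simp [ht])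
  exact ⟨a, by simpa using ha.symm⟩

/-- `Hom(Z, W) ⟶ Hom(B, W) ⟶ Hom(A, W)` is exact. -/
theorem Realizes.exists_comp_right (h : S.Realizes x y δ) {W : C} (t : B ⟶ W) (ht : x ≫ t = 0) :
    ∃ s : Z ⟶ W, y ≫ s = t := by
  obtain ⟨a, ha, -⟩ := S.et3 h (S.realizes_zero_id (isZero_zero C) W) 0 t (by simp [ht])
  exact ⟨a, by simpa using ha⟩

/-- `Hom(W, B) ⟶ Hom(W, Z) ⟶ 𝔼(W, A)` is exact. -/
theorem Realizes.exists_lift (h : S.Realizes x y δ) {W : C} (z : W ⟶ Z)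
    (hz : pull S.E z δ = 0) : ∃ t : W ⟶ B, t ≫ y = z := by
  obtain ⟨b, -, hb⟩ := S.exists_middle (S.realizes_zero A W) h (𝟙 A) z (by simp [hz])
  exact ⟨biprod.inr ≫ b, by rw [Category.assoc, ← hb]; simp⟩

/-- `Hom(B, W) ⟶ Hom(A, W) ⟶ 𝔼(Z, W)` is exact. -/
theorem Realizes.exists_extension (h : S.Realizes x y δ) {W : C} (z : A ⟶ W)
    (hz : push S.E z δ = 0) : ∃ t : B ⟶ W, x ≫ t = z := by
  obtain ⟨b, hb, -⟩ := S.exists_middle h (S.realizes_zero W Z) z (𝟙 Z) (by simp [hz])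
  exact ⟨b ≫ biprod.fst, by rw [← Category.assoc, hb]; simp⟩

/-- `Hom(W, Z) ⟶ 𝔼(W, A) ⟶ 𝔼(W, B)` is exact. -/
theorem Realizes.exists_pull_eq (h : S.Realizes x y δ) {W : C} (ε : Ext S.E W A)
    (hε : push S.E x ε = 0) : ∃ z : W ⟶ Z, pull S.E z δ = ε := by
  obtain ⟨V, p, q, hV⟩ := S.exists_realizes ε
  -- As `x_* ε = 0`, the map `x` extends to the middle term of `ε`; (ET3) then induces the required
  -- map on third terms.
  obtain ⟨t, ht⟩ := hV.exists_extension x hε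
  obtain ⟨c, -, hc⟩ := S.et3 hV h (𝟙 A) t (by simp [ht])
  exact ⟨c, by simpa using hc.symm⟩

/-- `Hom(A, W) ⟶ 𝔼(Z, W) ⟶ 𝔼(B, W)` is exact. -/
theorem Realizes.exists_push_eq (h : S.Realizes x y δ) {W : C} (ε : Ext S.E Z W)
    (hε : pull S.E y ε = 0) : ∃ z : A ⟶ W, push S.E z δ = ε := by
  obtain ⟨V, p, q, hV⟩ := S.exists_realizes ε
  obtain ⟨t, ht⟩ := hV.exists_lift y hε
  obtain ⟨a, -, ha⟩ := S.et3op h hV t (𝟙 Z) (by simp [ht])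
  exact ⟨a, by simpa using ha⟩

/-- `𝔼(W, A) ⟶ 𝔼(W, B) ⟶ 𝔼(W, Z)` is exact. -/
theorem Realizes.exists_push_left_eq (h : S.Realizes x y δ) {W : C} (ε : Ext S.E W B)
    (hε : push S.E y ε = 0) : ∃ ε' : Ext S.E W A, push S.E x ε' = ε := by
  obtain ⟨V, p, q, hV⟩ := S.exists_realizes ε
  -- (ET4) gives a conflation `Z ⟶ G ⟶ W` of class `y_* ε = 0`. It splits, and pulling `δ''` back
  -- along a section yields the preimage.
  obtain ⟨G, d, e, h', δ'', -, -, -, hde, -, hx⟩ := S.et4 h hV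
  obtain ⟨s, hs⟩ := hde.exists_lift (𝟙 W) (by simp [hε])
  exact ⟨pull S.E s δ'', by rw [push_pull, hx, ← pull_comp, hs, pull_id]⟩

/-- `𝔼(Z, W) ⟶ 𝔼(B, W) ⟶ 𝔼(A, W)` is exact. -/
theorem Realizes.exists_pull_right_eq (h : S.Realizes x y δ) {W : C} (ε : Ext S.E B W)
    (hε : pull S.E x ε = 0) : ∃ ε' : Ext S.E Z W, pull S.E y ε' = ε := by
  obtain ⟨V, p, q, hV⟩ := S.exists_realizes ε
  obtain ⟨G, d, e, h', δ'', -, -, -, hde, -, hx⟩ := S.et4op hV h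
  obtain ⟨s, hs⟩ := hde.exists_extension (𝟙 W) (by simp [hε])
  exact ⟨push S.E s δ'', by rw [← push_pull, ← hx, ← push_comp, hs, push_id]⟩

end Exactness

/-! ### Isomorphisms of conflations; inflations and deflations. -/

section Isos

variable {A B Z A' B' Z' : C} {x : A ⟶ B} {y : B ⟶ Z} {δ : Ext S.E Z A}
  {x' : A' ⟶ B'} {y' : B' ⟶ Z'} {δ' : Ext S.E Z' A'}

/-- A five lemma. For a right inverse of `b`, lift `y' ≫ inv c` along `y`; the error is killed by
`y'`, so it factors through `x'` and can be corrected through `x`. A left inverse is dual. -/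
theorem Realizes.isIso_middle (h : S.Realizes x y δ) (h' : S.Realizes x' y' δ')
    (a : A ⟶ A') (b : B ⟶ B') (c : Z ⟶ Z') [IsIso a] [IsIso c] (hx : x ≫ b = a ≫ x')
    (hy : y ≫ c = b ≫ y') (hδ : push S.E a δ = pull S.E c δ') : IsIso b := by
  obtain ⟨r, hr⟩ : ∃ r : B' ⟶ B, r ≫ b = 𝟙 B' := by
    obtain ⟨t, ht⟩ := h.exists_lift (y' ≫ inv c) (by
      have : δ = push S.E (inv a) (pull S.E c δ') := by
        rw [← hδ, ← push_comp, IsIso.hom_inv_id, push_id]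
      rw [this, ← push_pull, ← pull_comp, Category.assoc, IsIso.inv_hom_id, Category.comp_id,
        h'.pull_eq_zero, push_map_zero])
    obtain ⟨s, hs⟩ := h'.exists_comp_left (𝟙 B' - t ≫ b) (by
      simp [← hy, reassoc_of% ht])
    exact ⟨t + s ≫ inv a ≫ x, by simp [hx, hs]⟩
  obtain ⟨l, hl⟩ : ∃ l : B' ⟶ B, b ≫ l = 𝟙 B := by
    obtain ⟨t, ht⟩ := h'.exists_extension (inv a ≫ x) (by
      have : δ' = pull S.E (inv c) (push S.E a δ) := by
        rw [hδ, ← pull_comp, IsIso.inv_hom_id, pull_id]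
      rw [this, push_pull, ← push_comp, IsIso.hom_inv_id_assoc, h.push_eq_zero, pull_map_zero])
    obtain ⟨s, hs⟩ := h.exists_comp_right (𝟙 B - b ≫ t) (by
      simp [reassoc_of% hx, ht])
    exact ⟨t + y' ≫ inv c ≫ s, by simp [← reassoc_of% hy, hs]⟩
  have : l = r := by
    rw [← Category.id_comp l, ← hr, Category.assoc, hl, Category.comp_id]
  exact ⟨l, hl, by rw [this, hr]⟩

/-- Compatibility with the classes is essential. Since `x_* δ' = 0`, `δ' = z^* δ` for some `z`,
which is a section of `c` up to a map lifting along `y'`. If `z ≫ c = 0` then `z^* δ = 0`, so `z`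
lifts to `B`; the lift is killed by `y'`, hence factors through `x`, and `z = 0`. So `c` is monic
and split epic. -/
theorem Realizes.isIso_right (h : S.Realizes x y δ) {Z' : C} {y' : B ⟶ Z'} {δ' : Ext S.E Z' A}
    (h' : S.Realizes x y' δ') (c : Z ⟶ Z') (hy : y ≫ c = y') (hδ : δ = pull S.E c δ') :
    IsIso c := by
  obtain ⟨r, hr⟩ : ∃ r : Z' ⟶ Z, r ≫ c = 𝟙 Z' := by
    obtain ⟨z, hz⟩ := h.exists_pull_eq δ' h'.push_eq_zero
    obtain ⟨t, ht⟩ := h'.exists_lift (𝟙 Z' - z ≫ c) (by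
      rw [pull_sub, pull_id, pull_comp, ← hδ, hz, sub_self])
    exact ⟨z + t ≫ y, by simp [hy, ht]⟩
  have key : ∀ {W : C} (z : W ⟶ Z), z ≫ c = 0 → z = 0 := by
    intro W z hz
    obtain ⟨t, ht⟩ := h.exists_lift z (by rw [hδ, ← pull_comp, hz, pull_zero])
    obtain ⟨s, hs⟩ := h'.exists_comp_left t (by rw [← hy, reassoc_of% ht, hz])
    rw [← ht, ← hs, Category.assoc, h.comp_eq_zero, comp_zero]
  exact ⟨r, sub_eq_zero.1 (key _ (by simp [hr])), hr⟩

/-- The third term of an `𝔼`-triangle may be replaced by an isomorphic object. -/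
theorem Realizes.comp_iso (h : S.Realizes x y δ) (e : Z ≅ Z') :
    S.Realizes x (y ≫ e.hom) (pull S.E e.inv δ) := by
  obtain ⟨B', x', y', h'⟩ := S.exists_realizes (pull S.E e.inv δ)
  have hδ : push S.E (𝟙 A) δ = pull S.E e.hom (pull S.E e.inv δ) := by simp [← pull_comp]
  obtain ⟨b, hx, hy⟩ := S.exists_middle h h' (𝟙 A) e.hom hδ
  have := h.isIso_middle h' _ b _ hx hy hδ
  exact (S.realizes_iff _ _ h').2 ⟨(asIso b).symm, by simp [← cancel_mono b, hx], by
    simp [hy]⟩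

/-- The first term of an `𝔼`-triangle may be replaced by an isomorphic object. -/
theorem Realizes.iso_comp (h : S.Realizes x y δ) (e : A' ≅ A) :
    S.Realizes (e.hom ≫ x) y (push S.E e.inv δ) := by
  obtain ⟨B', x', y', h'⟩ := S.exists_realizes (push S.E e.inv δ)
  have hδ : push S.E e.inv δ = pull S.E (𝟙 Z) (push S.E e.inv δ) := by simp
  obtain ⟨b, hx, hy⟩ := S.exists_middle h h' e.inv (𝟙 Z) hδ
  have := h.isIso_middle h' _ b _ hx hy hδ
  refine (S.realizes_iff _ _ h').2 ⟨(asIso b).symm, ?_, ?_⟩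
  · simp [← cancel_mono b, hx]
  · rw [← cancel_epi b]; simpa using hy

theorem IsConflation.comp_iso (h : S.IsConflation x y) (e : Z ≅ Z') :
    S.IsConflation x (y ≫ e.hom) :=
  ⟨_, h.choose_spec.comp_iso e⟩

theorem IsConflation.iso_comp (h : S.IsConflation x y) (e : A' ≅ A) :
    S.IsConflation (e.hom ≫ x) y :=
  ⟨_, h.choose_spec.iso_comp e⟩

theorem IsConflation.middle_iso (h : S.IsConflation x y) (e : B ≅ B') :
    S.IsConflation (x ≫ e.hom) (e.inv ≫ y) :=
  ⟨_, (S.realizes_iff _ _ h.choose_spec).2 ⟨e, rfl, by simp⟩⟩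

theorem IsConflation.comp_eq_zero (h : S.IsConflation x y) : x ≫ y = 0 :=
  h.choose_spec.comp_eq_zero

/-- If the inflation of a conflation is an isomorphism, then its third term vanishes. -/
theorem IsConflation.isZero_right (h : S.IsConflation x y) [IsIso x] : IsZero Z := by
  obtain ⟨δ, h⟩ := h
  have hδ : δ = 0 := by
    rw [← push_id S.E δ, ← IsIso.hom_inv_id x, push_comp, h.push_eq_zero, push_map_zero]
  have hy : y = 0 := by rw [← cancel_epi x, h.comp_eq_zero, comp_zero]
  obtain ⟨t, ht⟩ := h.exists_lift (𝟙 Z) (by simp [hδ])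
  rw [IsZero.iff_id_eq_zero, ← ht, hy, comp_zero]

/-- If the deflation of a conflation is an isomorphism, then its first term vanishes. -/
theorem IsConflation.isZero_left (h : S.IsConflation x y) [IsIso y] : IsZero A := by
  obtain ⟨δ, h⟩ := h
  have hδ : δ = 0 := by
    rw [← pull_id S.E δ, ← IsIso.inv_hom_id y, pull_comp, h.pull_eq_zero, pull_map_zero]
  have hx : x = 0 := by rw [← cancel_mono y, h.comp_eq_zero, zero_comp]
  obtain ⟨t, ht⟩ := h.exists_extension (𝟙 A) (by simp [hδ])
  rw [IsZero.iff_id_eq_zero, ← ht, hx, zero_comp]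

theorem IsConflation.isIso_of_isZero_right (h : S.IsConflation x y) (hZ : IsZero Z) :
    IsIso x := by
  obtain ⟨δ, h⟩ := h
  obtain ⟨r, hr⟩ := h.exists_extension (𝟙 A) (S.ext_eq_zero_of_isZero_left hZ _)
  obtain ⟨s, hs⟩ := h.exists_comp_left (𝟙 B) (hZ.eq_of_tgt _ _)
  have : s = r := by
    rw [← Category.comp_id s, ← hr, ← Category.assoc, hs, Category.id_comp]
  exact ⟨r, hr, by rw [← this, hs]⟩

theorem IsConflation.isIso_of_isZero_left (h : S.IsConflation x y) (hA : IsZero A) :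
    IsIso y := by
  obtain ⟨δ, h⟩ := h
  obtain ⟨r, hr⟩ := h.exists_lift (𝟙 Z) (S.ext_eq_zero_of_isZero_right hA _)
  obtain ⟨s, hs⟩ := h.exists_comp_right (𝟙 B) (hA.eq_of_src _ _)
  have : s = r := by
    rw [← Category.id_comp s, ← hr, Category.assoc, hs, Category.comp_id]
  exact ⟨r, by rw [← this, hs], hr⟩

theorem IsInflation.comp {f : A ⟶ B} {g : B ⟶ Z} (hf : S.IsInflation f) (hg : S.IsInflation g) :
    S.IsInflation (f ≫ g) := by
  obtain ⟨_, _, _, hf⟩ := hf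
  obtain ⟨_, _, _, hg⟩ := hg
  obtain ⟨G, _, _, h', δ'', -, -, h, -⟩ := S.et4 hf hg
  exact ⟨G, h', δ'', h⟩

theorem IsDeflation.comp {f : A ⟶ B} {g : B ⟶ Z} (hf : S.IsDeflation f) (hg : S.IsDeflation g) :
    S.IsDeflation (f ≫ g) := by
  obtain ⟨_, _, _, hf⟩ := hf
  obtain ⟨_, _, _, hg⟩ := hg
  obtain ⟨G, _, _, h', δ'', -, -, h, -⟩ := S.et4op hf hg
  exact ⟨G, h', δ'', h⟩

/-- Factor `(f, a)` as `(f, 𝟙)` followed by `𝟙 ⊕ a`. The first is a split inclusion up to a shear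
isomorphism; the second is a direct sum of inflations. -/
theorem IsInflation.biprod_lift {a : A ⟶ B} (ha : S.IsInflation a) {Y : C} (f : A ⟶ Y) :
    S.IsInflation (biprod.lift f a) := by
  obtain ⟨Z, p, δ, h⟩ := ha
  have h₁ : S.IsInflation (biprod.lift f (𝟙 A)) := by
    let e : A ⊞ Y ≅ Y ⊞ A :=
      { hom := biprod.desc (biprod.lift f (𝟙 A)) biprod.inl
        inv := biprod.desc biprod.inr (biprod.inl - f ≫ biprod.inr)
        hom_inv_id := by ext <;> simp
        inv_hom_id := by ext <;> simp }
    have := IsConflation.middle_iso ⟨_, S.realizes_zero A Y⟩ e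
    have he : biprod.inl ≫ e.hom = biprod.lift f (𝟙 A) := by simp [e]
    rw [he] at this
    exact ⟨_, _, this⟩
  have h₂ : S.IsInflation (biprod.map (𝟙 Y) a) :=
    ⟨_, _, _, S.realizes_sum (S.realizes_id_zero Y (isZero_zero C)) h⟩
  have : biprod.lift f (𝟙 A) ≫ biprod.map (𝟙 Y) a = biprod.lift f a := by ext <;> simp
  exact this ▸ h₁.comp h₂

theorem IsDeflation.biprod_desc {g : A ⟶ B} (hg : S.IsDeflation g) {Y : C} (f : Y ⟶ B) :
    S.IsDeflation (biprod.desc f g) := by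
  obtain ⟨Z, p, δ, h⟩ := hg
  have h₁ : S.IsDeflation (biprod.desc f (𝟙 B)) := by
    let e : Y ⊞ B ≅ Y ⊞ B :=
      { hom := biprod.desc (biprod.inl - f ≫ biprod.inr) biprod.inr
        inv := biprod.desc (biprod.inl + f ≫ biprod.inr) biprod.inr
        hom_inv_id := by ext <;> simp
        inv_hom_id := by ext <;> simp }
    have := IsConflation.middle_iso ⟨_, S.realizes_zero Y B⟩ e
    have he : e.inv ≫ biprod.snd = biprod.desc f (𝟙 B) := by ext <;> simp [e]
    rw [he] at this
    exact ⟨_, _, this⟩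
  have h₂ : S.IsDeflation (biprod.map (𝟙 Y) g) :=
    ⟨_, _, _, S.realizes_sum (S.realizes_zero_id (isZero_zero C) Y) h⟩
  have : biprod.map (𝟙 Y) g ≫ biprod.desc f (𝟙 B) = biprod.desc f g := by ext <;> simp
  exact this ▸ h₂.comp h₁

end Isos

end ExtriangulatedStructure

/-! ### Monomorphisms, epimorphisms, kernels and cokernels modulo an ideal. -/

section Ideal

variable {C : Type u} [Category.{v} C] [Preadditive C] {𝒯 : ObjectProperty C}

theorem comp_comp_mem_idealOf {X T Y : C} (hT : 𝒯 T) (a : X ⟶ T) (b : T ⟶ Y) :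
    a ≫ b ∈ idealOf 𝒯 X Y :=
  AddSubgroup.subset_closure ⟨T, a, b, hT, rfl⟩

instance : (proj 𝒯).Additive where
  map_add := rfl

theorem proj_map_eq_iff {X Y : C} (f g : X ⟶ Y) :
    (proj 𝒯).map f = (proj 𝒯).map g ↔ f - g ∈ idealOf 𝒯 X Y :=
  CategoryTheory.Quotient.functor_map_eq_iff _ _ _

theorem proj_map_eq_zero_iff {X Y : C} (f : X ⟶ Y) :
    (proj 𝒯).map f = 0 ↔ f ∈ idealOf 𝒯 X Y := by
  rw [← (proj 𝒯).map_zero, proj_map_eq_iff, sub_zero]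

theorem mono_proj_map_iff {X Y : C} (f : X ⟶ Y) :
    Mono ((proj 𝒯).map f) ↔
      ∀ ⦃W : C⦄ (v : W ⟶ X), v ≫ f ∈ idealOf 𝒯 W Y → v ∈ idealOf 𝒯 W X := by
  constructor
  · intro h W v hv
    rw [← proj_map_eq_zero_iff] at hv ⊢
    rw [Functor.map_comp] at hv
    exact (Preadditive.mono_iff_cancel_zero _).1 h _ _ hv
  · intro h
    refine (Preadditive.mono_iff_cancel_zero _).2 ?_
    rintro ⟨W⟩ v hv
    obtain ⟨v, rfl⟩ := (proj 𝒯).map_surjective (X := W) v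
    rw [← Functor.map_comp, proj_map_eq_zero_iff] at hv
    exact (proj_map_eq_zero_iff _).2 (h v hv)

theorem epi_proj_map_iff {X Y : C} (f : X ⟶ Y) :
    Epi ((proj 𝒯).map f) ↔
      ∀ ⦃W : C⦄ (v : Y ⟶ W), f ≫ v ∈ idealOf 𝒯 X W → v ∈ idealOf 𝒯 Y W := by
  constructor
  · intro h W v hv
    rw [← proj_map_eq_zero_iff] at hv ⊢
    rw [Functor.map_comp] at hv
    exact (Preadditive.epi_iff_cancel_zero _).1 h _ _ hv
  · intro h
    refine (Preadditive.epi_iff_cancel_zero _).2 ?_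
    rintro ⟨W⟩ v hv
    obtain ⟨v, rfl⟩ := (proj 𝒯).map_surjective (Y := W) v
    rw [← Functor.map_comp, proj_map_eq_zero_iff] at hv
    exact (proj_map_eq_zero_iff _).2 (h v hv)

theorem proj_map_comp_eq_zero {X Y Z : C} {f : X ⟶ Y} {g : Y ⟶ Z}
    (h : f ≫ g ∈ idealOf 𝒯 X Z) : (proj 𝒯).map f ≫ (proj 𝒯).map g = 0 := by
  rwa [← Functor.map_comp, proj_map_eq_zero_iff]

/-- A morphism that is monic and a weak kernel modulo the ideal is a kernel in the quotient. -/
theorem nonempty_isLimit_kernelFork_proj {K X Y : C} {k : K ⟶ X} {f : X ⟶ Y}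
    (hkf : k ≫ f ∈ idealOf 𝒯 K Y)
    (hw : ∀ ⦃W : C⦄ (u : W ⟶ X), u ≫ f ∈ idealOf 𝒯 W Y → ∃ s : W ⟶ K, s ≫ k - u ∈ idealOf 𝒯 W X)
    [Mono ((proj 𝒯).map k)] :
    Nonempty (IsLimit (KernelFork.ofι ((proj 𝒯).map k) (proj_map_comp_eq_zero hkf))) := by
  have key : ∀ {W : IdealQuotient 𝒯} (u : W ⟶ (proj 𝒯).obj X), u ≫ (proj 𝒯).map f = 0 →
      ∃ s : W ⟶ (proj 𝒯).obj K, s ≫ (proj 𝒯).map k = u := by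
    rintro ⟨W⟩ u hu
    obtain ⟨u, rfl⟩ := (proj 𝒯).map_surjective (X := W) u
    rw [← Functor.map_comp, proj_map_eq_zero_iff] at hu
    obtain ⟨s, hs⟩ := hw u hu
    exact ⟨(proj 𝒯).map s, by rw [← Functor.map_comp, proj_map_eq_iff]; exact hs⟩
  exact ⟨KernelFork.IsLimit.ofι' _ _ fun u hu => ⟨(key u hu).choose, (key u hu).choose_spec⟩⟩

/-- A morphism that is epic and a weak cokernel modulo the ideal is a cokernel in the quotient. -/
theorem nonempty_isColimit_cokernelCofork_proj {X Y Z : C} {f : X ⟶ Y} {p : Y ⟶ Z}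
    (hfp : f ≫ p ∈ idealOf 𝒯 X Z)
    (hw : ∀ ⦃W : C⦄ (u : Y ⟶ W), f ≫ u ∈ idealOf 𝒯 X W → ∃ s : Z ⟶ W, p ≫ s - u ∈ idealOf 𝒯 Y W)
    [Epi ((proj 𝒯).map p)] :
    Nonempty (IsColimit (CokernelCofork.ofπ ((proj 𝒯).map p) (proj_map_comp_eq_zero hfp))) := by
  have key : ∀ {W : IdealQuotient 𝒯} (u : (proj 𝒯).obj Y ⟶ W), (proj 𝒯).map f ≫ u = 0 →
      ∃ s : (proj 𝒯).obj Z ⟶ W, (proj 𝒯).map p ≫ s = u := by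
    rintro ⟨W⟩ u hu
    obtain ⟨u, rfl⟩ := (proj 𝒯).map_surjective (Y := W) u
    rw [← Functor.map_comp, proj_map_eq_zero_iff] at hu
    obtain ⟨s, hs⟩ := hw u hu
    exact ⟨(proj 𝒯).map s, by rw [← Functor.map_comp, proj_map_eq_iff]; exact hs⟩
  exact ⟨CokernelCofork.IsColimit.ofπ' _ _ fun u hu => ⟨(key u hu).choose, (key u hu).choose_spec⟩⟩

end Ideal

/-! ### The abelian quotient by a cluster tilting subcategory. -/

namespace ExtriangulatedStructure

variable {C : Type u} [Category.{v} C] [Preadditive C] [HasZeroObject C] [HasBinaryBiproducts C]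
  {S : ExtriangulatedStructure.{w} C} {𝒯 : ObjectProperty C}

namespace IsClusterTilting

variable (h : S.IsClusterTilting 𝒯)
include h

theorem ext_eq_zero {T T' : C} (hT : 𝒯 T) (hT' : 𝒯 T') (δ : Ext S.E T T') : δ = 0 :=
  (h.mem_iff_left T).1 hT T' hT' δ

/-- The third term is in `𝒯` because `𝔼(T, T') = 0` forces each class in `𝔼(L, T')` to be `z_* δ`
with `z : X ⟶ T'`; such a `z` extends over the approximation `f`, and `f_* δ = 0`. -/
theorem exists_coresolution (X : C) : ∃ (T L : C) (f : X ⟶ T) (l : T ⟶ L) (δ : Ext S.E L X),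
    S.Realizes f l δ ∧ IsLeftApprox 𝒯 f ∧ 𝒯 L := by
  obtain ⟨T, L, f, l, ⟨δ, hδ⟩, hf⟩ := h.covariantlyFinite X
  refine ⟨T, L, f, l, δ, hδ, hf, (h.mem_iff_left L).2 fun T' hT' ε => ?_⟩
  obtain ⟨z, rfl⟩ := hδ.exists_push_eq ε (h.ext_eq_zero hf.1 hT' _)
  obtain ⟨k, rfl⟩ := hf.2 T' hT' z
  rw [push_comp, hδ.push_eq_zero, push_map_zero]

theorem exists_resolution (X : C) : ∃ (K T : C) (k : K ⟶ T) (g : T ⟶ X) (δ : Ext S.E X K),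
    S.Realizes k g δ ∧ IsRightApprox 𝒯 g ∧ 𝒯 K := by
  obtain ⟨K, T, k, g, ⟨δ, hδ⟩, hg⟩ := h.contravariantlyFinite X
  refine ⟨K, T, k, g, δ, hδ, hg, (h.mem_iff_right K).2 fun T' hT' ε => ?_⟩
  obtain ⟨z, rfl⟩ := hδ.exists_pull_eq ε (h.ext_eq_zero hT' hg.1 _)
  obtain ⟨k, rfl⟩ := hg.2 T' hT' z
  rw [pull_comp, hδ.pull_eq_zero, pull_map_zero]

theorem push_eq_zero_of_mem {X Y : C} {f : X ⟶ Y} (hf : f ∈ idealOf 𝒯 X Y) {T : C} (hT : 𝒯 T)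
    (ε : Ext S.E T X) : push S.E f ε = 0 := by
  induction hf using AddSubgroup.closure_induction with
  | mem f hf =>
    obtain ⟨T', a, b, hT', rfl⟩ := hf
    rw [push_comp, h.ext_eq_zero hT hT' (push S.E a ε), push_map_zero]
  | zero => exact S.push_zero ε
  | add a b _ _ ha hb => rw [push_add, ha, hb, add_zero]
  | neg a _ ha => rw [push_neg, ha, neg_zero]

theorem pull_eq_zero_of_mem {X Y : C} {f : X ⟶ Y} (hf : f ∈ idealOf 𝒯 X Y) {T : C} (hT : 𝒯 T)
    (ε : Ext S.E Y T) : pull S.E f ε = 0 := by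
  induction hf using AddSubgroup.closure_induction with
  | mem f hf =>
    obtain ⟨T', a, b, hT', rfl⟩ := hf
    rw [pull_comp, h.ext_eq_zero hT' hT (pull S.E b ε), pull_map_zero]
  | zero => exact S.pull_zero ε
  | add a b _ _ ha hb => rw [pull_add, ha, hb, add_zero]
  | neg a _ ha => rw [pull_neg, ha, neg_zero]

/-- A single class suffices: that of the coresolution `X ⟶ T ⟶ L`, where `L` is in `𝒯`. If `f` kills
it, then `f` extends over `T`. -/
theorem exists_factorization_of_push {X Y : C} {f : X ⟶ Y}
    (hf : ∀ T : C, 𝒯 T → ∀ ε : Ext S.E T X, push S.E f ε = 0) :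
    ∃ (T : C) (a : X ⟶ T) (b : T ⟶ Y), 𝒯 T ∧ a ≫ b = f := by
  obtain ⟨T, L, a, l, δ, hδ, ha, hL⟩ := h.exists_coresolution X
  obtain ⟨b, hb⟩ := hδ.exists_extension f (hf L hL δ)
  exact ⟨T, a, b, ha.1, hb⟩

theorem exists_factorization_of_pull {X Y : C} {f : X ⟶ Y}
    (hf : ∀ T : C, 𝒯 T → ∀ ε : Ext S.E Y T, pull S.E f ε = 0) :
    ∃ (T : C) (a : X ⟶ T) (b : T ⟶ Y), 𝒯 T ∧ a ≫ b = f := by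
  obtain ⟨K, T, k, g, δ, hδ, hg, hK⟩ := h.exists_resolution Y
  obtain ⟨a, ha⟩ := hδ.exists_lift f (hf K hK δ)
  exact ⟨T, a, g, hg.1, ha⟩

/-- A morphism lies in `[𝒯]` if and only if it acts as zero on `𝔼(𝒯, -)`. -/
theorem mem_idealOf_iff_push {X Y : C} (f : X ⟶ Y) :
    f ∈ idealOf 𝒯 X Y ↔ ∀ T : C, 𝒯 T → ∀ ε : Ext S.E T X, push S.E f ε = 0 := by
  refine ⟨fun hf T hT ε => h.push_eq_zero_of_mem hf hT ε, fun hf => ?_⟩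
  obtain ⟨T, a, b, hT, rfl⟩ := h.exists_factorization_of_push hf
  exact comp_comp_mem_idealOf hT a b

/-- A morphism lies in `[𝒯]` if and only if it acts as zero on `𝔼(-, 𝒯)`. -/
theorem mem_idealOf_iff_pull {X Y : C} (f : X ⟶ Y) :
    f ∈ idealOf 𝒯 X Y ↔ ∀ T : C, 𝒯 T → ∀ ε : Ext S.E Y T, pull S.E f ε = 0 := by
  refine ⟨fun hf T hT ε => h.pull_eq_zero_of_mem hf hT ε, fun hf => ?_⟩
  obtain ⟨T, a, b, hT, rfl⟩ := h.exists_factorization_of_pull hf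
  exact comp_comp_mem_idealOf hT a b

/-- The action on `𝔼(𝒯, -)` is additive in the morphism, so a sum of factorizations reduces to one
without choosing direct sums in `𝒯`. -/
theorem exists_factorization {X Y : C} {f : X ⟶ Y} (hf : f ∈ idealOf 𝒯 X Y) :
    ∃ (T : C) (a : X ⟶ T) (b : T ⟶ Y), 𝒯 T ∧ a ≫ b = f :=
  h.exists_factorization_of_push ((h.mem_idealOf_iff_push f).1 hf)

/-- The identity of `X` acts as zero on `𝔼(𝒯, X)` exactly when these groups vanish, which is the
defining condition for `X` to lie in `𝒯`. -/
theorem isZero_proj_obj_iff (X : C) : IsZero ((proj 𝒯).obj X) ↔ 𝒯 X := by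
  rw [IsZero.iff_id_eq_zero, ← (proj 𝒯).map_id, proj_map_eq_zero_iff, h.mem_idealOf_iff_push,
    h.mem_iff_right]
  simp

/-- A morphism inducing injections on `𝔼(𝒯, -)` is a monomorphism modulo `[𝒯]`. -/
theorem mono_proj_map_of_push {X Y : C} {f : X ⟶ Y}
    (hf : ∀ T : C, 𝒯 T → ∀ ε : Ext S.E T X, push S.E f ε = 0 → ε = 0) :
    Mono ((proj 𝒯).map f) := by
  rw [mono_proj_map_iff]
  intro W v hv
  rw [h.mem_idealOf_iff_push] at hv ⊢
  exact fun T hT ε => hf T hT _ (by rw [← push_comp, hv T hT])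

/-- A morphism inducing injections on `𝔼(-, 𝒯)` is an epimorphism modulo `[𝒯]`. -/
theorem epi_proj_map_of_pull {X Y : C} {f : X ⟶ Y}
    (hf : ∀ T : C, 𝒯 T → ∀ ε : Ext S.E Y T, pull S.E f ε = 0 → ε = 0) :
    Epi ((proj 𝒯).map f) := by
  rw [epi_proj_map_iff]
  intro W v hv
  rw [h.mem_idealOf_iff_pull] at hv ⊢
  exact fun T hT ε => hf T hT _ (by rw [← pull_comp, hv T hT])

/-- A right approximation of `Y` is added to `f` to obtain a deflation; the summand `T` is invisible
modulo `[𝒯]`, so `k` becomes a kernel of `f`. -/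
theorem exists_kernel_conflation {X Y : C} (f : X ⟶ Y) :
    ∃ (K T : C) (k : K ⟶ X) (t : K ⟶ T) (g : T ⟶ Y) (δ : Ext S.E Y K),
      S.Realizes (biprod.lift k t) (biprod.desc f g) δ ∧ IsRightApprox 𝒯 g := by
  obtain ⟨_, T, k, g, hg, hg'⟩ := h.contravariantlyFinite Y
  obtain ⟨K, x, δ, hx⟩ := IsDeflation.biprod_desc ⟨_, _, hg⟩ f
  refine ⟨K, T, x ≫ biprod.fst, x ≫ biprod.snd, g, δ, ?_, hg'⟩
  convert hx
  ext <;> simp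

theorem exists_cokernel_conflation {X Y : C} (f : X ⟶ Y) :
    ∃ (T Z : C) (a : X ⟶ T) (p : Y ⟶ Z) (q : T ⟶ Z) (δ : Ext S.E Z X),
      S.Realizes (biprod.lift f a) (biprod.desc p q) δ ∧ IsLeftApprox 𝒯 a := by
  obtain ⟨T, _, a, _, ha, ha'⟩ := h.covariantlyFinite X
  obtain ⟨Z, x, δ, hx⟩ := IsInflation.biprod_lift ⟨_, _, ha⟩ f
  refine ⟨T, Z, a, biprod.inl ≫ x, biprod.inr ≫ x, δ, ?_, ha'⟩
  convert hx
  ext <;> simp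

section Kernel

variable {K T X Y : C} {k : K ⟶ X} {t : K ⟶ T} {f : X ⟶ Y} {g : T ⟶ Y} {δ : Ext S.E Y K}

omit h in
theorem comp_mem_of_kernel_conflation
    (hδ : S.Realizes (biprod.lift k t) (biprod.desc f g) δ) (hT : 𝒯 T) :
    k ≫ f ∈ idealOf 𝒯 K Y := by
  have := hδ.comp_eq_zero
  rw [biprod.lift_desc, add_eq_zero_iff_eq_neg] at this
  rw [this]
  exact neg_mem (comp_comp_mem_idealOf hT t g)

theorem exists_lift_of_kernel_conflation
    (hδ : S.Realizes (biprod.lift k t) (biprod.desc f g) δ) (hg : IsRightApprox 𝒯 g)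
    {W : C} (u : W ⟶ X) (hu : u ≫ f ∈ idealOf 𝒯 W Y) : ∃ s : W ⟶ K, s ≫ k = u := by
  obtain ⟨T', a, b, hT', hab⟩ := h.exists_factorization hu
  obtain ⟨b, rfl⟩ := hg.2 T' hT' b
  obtain ⟨s, hs⟩ := hδ.exists_comp_left (biprod.lift u (-(a ≫ b))) (by simp [hab])
  exact ⟨s, by simpa using hs =≫ biprod.fst⟩

/-- If `k_* ε = 0` then also `t_* ε = 0` by rigidity, so `ε = z^* δ` with `z : T' ⟶ Y`. This `z`
factors through the approximation `g`, hence through the deflation, which kills `δ`. -/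
theorem mono_of_kernel_conflation
    (hδ : S.Realizes (biprod.lift k t) (biprod.desc f g) δ) (hg : IsRightApprox 𝒯 g) :
    Mono ((proj 𝒯).map k) := by
  refine h.mono_proj_map_of_push fun T' hT' ε hε => ?_
  obtain ⟨z, rfl⟩ := hδ.exists_pull_eq ε (by
    have : biprod.lift k t = k ≫ biprod.inl + t ≫ biprod.inr := by ext <;> simp
    rw [this, push_add, push_comp, push_comp, hε, h.ext_eq_zero hT' hg.1 (push S.E t ε),
      push_map_zero, push_map_zero, add_zero])
  obtain ⟨b, rfl⟩ := hg.2 T' hT' z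
  have : b ≫ g = (b ≫ biprod.inr) ≫ biprod.desc f g := by simp
  rw [this, pull_comp, hδ.pull_eq_zero, pull_map_zero]

/-- Converse of `mono_proj_map_of_push`. A class killed by `f` comes from `𝔼(T', K)` through `k`; as
`f` is monic modulo `[𝒯]`, `k` lies in the ideal and acts as zero. -/
theorem push_injective_of_mono [Mono ((proj 𝒯).map f)] {T' : C} (hT' : 𝒯 T')
    (ε : Ext S.E T' X) (hε : push S.E f ε = 0) : ε = 0 := by
  obtain ⟨K, T, k, t, g, δ, hδ, hg⟩ := h.exists_kernel_conflation f
  obtain ⟨ε', hε'⟩ := hδ.exists_push_left_eq (push S.E biprod.inl ε) (by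
    rw [← push_comp, biprod.inl_desc, hε])
  have hk := (mono_proj_map_iff f).1 inferInstance k (comp_mem_of_kernel_conflation hδ hg.1)
  have := congrArg (push S.E biprod.fst) hε'
  rw [← push_comp, ← push_comp, biprod.lift_fst, biprod.inl_fst, push_id] at this
  rw [← this, h.push_eq_zero_of_mem hk hT']

end Kernel

section Cokernel

variable {T X Y Z : C} {f : X ⟶ Y} {a : X ⟶ T} {p : Y ⟶ Z} {q : T ⟶ Z} {δ : Ext S.E Z X}

omit h in
theorem comp_mem_of_cokernel_conflation
    (hδ : S.Realizes (biprod.lift f a) (biprod.desc p q) δ) (hT : 𝒯 T) :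
    f ≫ p ∈ idealOf 𝒯 X Z :=
  comp_mem_of_kernel_conflation hδ hT

theorem exists_desc_of_cokernel_conflation
    (hδ : S.Realizes (biprod.lift f a) (biprod.desc p q) δ) (ha : IsLeftApprox 𝒯 a)
    {W : C} (u : Y ⟶ W) (hu : f ≫ u ∈ idealOf 𝒯 X W) : ∃ s : Z ⟶ W, p ≫ s = u := by
  obtain ⟨T', b, c, hT', hbc⟩ := h.exists_factorization hu
  obtain ⟨b, rfl⟩ := ha.2 T' hT' b
  obtain ⟨s, hs⟩ := hδ.exists_comp_right (biprod.desc u (-(b ≫ c))) (by simp [← hbc])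
  exact ⟨s, by simpa using biprod.inl ≫= hs⟩

theorem epi_of_cokernel_conflation
    (hδ : S.Realizes (biprod.lift f a) (biprod.desc p q) δ) (ha : IsLeftApprox 𝒯 a) :
    Epi ((proj 𝒯).map p) := by
  refine h.epi_proj_map_of_pull fun T' hT' ε hε => ?_
  obtain ⟨z, rfl⟩ := hδ.exists_push_eq ε (by
    have : biprod.desc p q = biprod.fst ≫ p + biprod.snd ≫ q := by ext <;> simp
    rw [this, pull_add, pull_comp, pull_comp, hε, h.ext_eq_zero ha.1 hT' (pull S.E q ε),
      pull_map_zero, pull_map_zero, add_zero])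
  obtain ⟨b, rfl⟩ := ha.2 T' hT' z
  have : a ≫ b = biprod.lift f a ≫ (biprod.snd ≫ b) := by simp
  rw [this, push_comp, hδ.push_eq_zero, push_map_zero]

theorem pull_injective_of_epi [Epi ((proj 𝒯).map f)] {T' : C} (hT' : 𝒯 T')
    (ε : Ext S.E Y T') (hε : pull S.E f ε = 0) : ε = 0 := by
  obtain ⟨T, Z, a, p, q, δ, hδ, ha⟩ := h.exists_cokernel_conflation f
  obtain ⟨ε', hε'⟩ := hδ.exists_pull_right_eq (pull S.E biprod.fst ε) (by
    rw [← pull_comp, biprod.lift_fst, hε])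
  have hp := (epi_proj_map_iff f).1 inferInstance p (comp_mem_of_cokernel_conflation hδ ha.1)
  have := congrArg (pull S.E biprod.inl) hε'
  rw [← pull_comp, ← pull_comp, biprod.inl_desc, biprod.inl_fst, pull_id] at this
  rw [← this, h.pull_eq_zero_of_mem hp hT']

end Cokernel

/-- A mono is shown to be the kernel of its cokernel `p`. -/
theorem nonempty_normalMono {X Y : C} (f : X ⟶ Y) [Mono ((proj 𝒯).map f)] :
    Nonempty (NormalMono ((proj 𝒯).map f)) := by
  obtain ⟨T, Z, a, p, q, δ, hδ, ha⟩ := h.exists_cokernel_conflation f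
  have hfp := comp_mem_of_cokernel_conflation hδ ha.1
  obtain ⟨hl⟩ := nonempty_isLimit_kernelFork_proj hfp (fun W u hu => by
    obtain ⟨T', m, n, hT', hmn⟩ := h.exists_factorization hu
    -- The class `n^* δ` is killed by `f`, on which `𝔼(T', -)` is injective. So `n` lifts to `Y ⊞
    -- T`, and subtracting `m ≫ r` changes `u` only within the ideal.
    have hn : pull S.E n δ = 0 := by
      refine h.push_injective_of_mono hT' (f := f) _ ?_
      rw [push_pull, ← biprod.lift_fst f a, push_comp, hδ.push_eq_zero, push_map_zero,
        pull_map_zero]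
    obtain ⟨r, rfl⟩ := hδ.exists_lift n hn
    obtain ⟨s, hs⟩ := hδ.exists_comp_left (u ≫ biprod.inl - m ≫ r) (by simp [hmn])
    refine ⟨s, ?_⟩
    have : s ≫ f = u - m ≫ r ≫ biprod.fst := by simpa using hs =≫ biprod.fst
    rw [this, sub_sub_cancel_left]
    exact neg_mem (comp_comp_mem_idealOf hT' _ _))
  exact ⟨⟨_, _, _, hl⟩⟩

theorem nonempty_normalEpi {X Y : C} (f : X ⟶ Y) [Epi ((proj 𝒯).map f)] :
    Nonempty (NormalEpi ((proj 𝒯).map f)) := by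
  obtain ⟨K, T, k, t, g, δ, hδ, hg⟩ := h.exists_kernel_conflation f
  have hkf := comp_mem_of_kernel_conflation hδ hg.1
  obtain ⟨hl⟩ := nonempty_isColimit_cokernelCofork_proj hkf (fun W u hu => by
    obtain ⟨T', m, n, hT', hmn⟩ := h.exists_factorization hu
    have hm : push S.E m δ = 0 := by
      refine h.pull_injective_of_epi hT' (f := f) _ ?_
      rw [← push_pull, ← biprod.inl_desc f g, pull_comp, hδ.pull_eq_zero, pull_map_zero,
        push_map_zero]
    obtain ⟨r, rfl⟩ := hδ.exists_extension m hm
    obtain ⟨s, hs⟩ := hδ.exists_comp_right (biprod.fst ≫ u - r ≫ n) (by simp [← hmn])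
    refine ⟨s, ?_⟩
    have : f ≫ s = u - (biprod.inl ≫ r) ≫ n := by simpa using biprod.inl ≫= hs
    rw [this, sub_sub_cancel_left]
    exact neg_mem (comp_comp_mem_idealOf hT' _ _))
  exact ⟨⟨_, _, _, hl⟩⟩

theorem hasKernels : HasKernels (IdealQuotient 𝒯) where
  has_limit := by
    rintro ⟨X⟩ ⟨Y⟩ f
    obtain ⟨f, rfl⟩ := (proj 𝒯).map_surjective (X := X) (Y := Y) f
    obtain ⟨K, T, k, t, g, δ, hδ, hg⟩ := h.exists_kernel_conflation f
    have := h.mono_of_kernel_conflation hδ hg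
    obtain ⟨hl⟩ := nonempty_isLimit_kernelFork_proj (comp_mem_of_kernel_conflation hδ hg.1)
      (fun W u hu => by
        obtain ⟨s, hs⟩ := h.exists_lift_of_kernel_conflation hδ hg u hu
        exact ⟨s, by simp [hs]⟩)
    exact ⟨⟨⟨_, hl⟩⟩⟩

theorem hasCokernels : HasCokernels (IdealQuotient 𝒯) where
  has_colimit := by
    rintro ⟨X⟩ ⟨Y⟩ f
    obtain ⟨f, rfl⟩ := (proj 𝒯).map_surjective (X := X) (Y := Y) f
    obtain ⟨T, Z, a, p, q, δ, hδ, ha⟩ := h.exists_cokernel_conflation f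
    have := h.epi_of_cokernel_conflation hδ ha
    obtain ⟨hl⟩ := nonempty_isColimit_cokernelCofork_proj
      (comp_mem_of_cokernel_conflation hδ ha.1)
      (fun W u hu => by
        obtain ⟨s, hs⟩ := h.exists_desc_of_cokernel_conflation hδ ha u hu
        exact ⟨s, by simp [hs]⟩)
    exact ⟨⟨⟨_, hl⟩⟩⟩

theorem isNormalMonoCategory : IsNormalMonoCategory (IdealQuotient 𝒯) where
  normalMonoOfMono := by
    rintro ⟨X⟩ ⟨Y⟩ f hf
    obtain ⟨f, rfl⟩ := (proj 𝒯).map_surjective (X := X) (Y := Y) f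
    exact h.nonempty_normalMono f

theorem isNormalEpiCategory : IsNormalEpiCategory (IdealQuotient 𝒯) where
  normalEpiOfEpi := by
    rintro ⟨X⟩ ⟨Y⟩ f hf
    obtain ⟨f, rfl⟩ := (proj 𝒯).map_surjective (X := X) (Y := Y) f
    exact h.nonempty_normalEpi f

/-- The quotient of an extriangulated category by a cluster tilting subcategory is abelian. -/
theorem isAbelianCategory : IsAbelianCategory (IdealQuotient 𝒯) := by
  have := h.hasKernels
  have := h.hasCokernels
  have := h.isNormalMonoCategory
  have := h.isNormalEpiCategory
  have : HasFiniteProducts C := hasFiniteProducts_of_has_binary_and_terminal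
  have := Functor.hasFiniteProducts_of_additive_of_essSurj (proj 𝒯)
  -- All fields are found by instance search, so the preadditive structure is the given one
  -- definitionally.
  exact ⟨{ }, rfl⟩

end IsClusterTilting

end ExtriangulatedStructure

/-! ### Functors and adjunctions induced on ideal quotients. -/

section QuotientFunctor

variable {A : Type u₁} [Category.{v₁} A] [Preadditive A]
  {B : Type u₂} [Category.{v₂} B] [Preadditive B]
  {𝒮 : ObjectProperty A} {𝒯 : ObjectProperty B}

theorem map_mem_idealOf (F : A ⥤ B) [F.Additive] (hF : ∀ X, 𝒮 X → 𝒯 (F.obj X)) {X Y : A}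
    {f : X ⟶ Y} (hf : f ∈ idealOf 𝒮 X Y) : F.map f ∈ idealOf 𝒯 (F.obj X) (F.obj Y) := by
  induction hf using AddSubgroup.closure_induction with
  | mem f hf =>
    obtain ⟨T, a, b, hT, rfl⟩ := hf
    rw [F.map_comp]
    exact comp_comp_mem_idealOf (hF T hT) _ _
  | zero => simp
  | add a b _ _ ha hb => rw [F.map_add]; exact add_mem ha hb
  | neg a _ ha => rw [F.map_neg]; exact neg_mem ha

/-- The functor between ideal quotients induced by an additive functor. -/
abbrev quotientFunctor (F : A ⥤ B) [F.Additive] (hF : ∀ X, 𝒮 X → 𝒯 (F.obj X)) :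
    IdealQuotient 𝒮 ⥤ IdealQuotient 𝒯 :=
  CategoryTheory.Quotient.lift _ (F ⋙ proj 𝒯) (fun X Y f g h => by
    refine (proj_map_eq_iff _ _).2 ?_
    rw [← F.map_sub]
    exact map_mem_idealOf F hF h)

theorem proj_comp_quotientFunctor (F : A ⥤ B) [F.Additive] (hF : ∀ X, 𝒮 X → 𝒯 (F.obj X)) :
    proj 𝒮 ⋙ quotientFunctor F hF = F ⋙ proj 𝒯 :=
  CategoryTheory.Quotient.lift_spec _ _ _

theorem quotientFunctor_additive (F : A ⥤ B) [F.Additive] (hF : ∀ X, 𝒮 X → 𝒯 (F.obj X)) :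
    (quotientFunctor F hF).Additive where
  map_add := by
    rintro ⟨X⟩ ⟨Y⟩ ⟨f⟩ ⟨g⟩
    exact congrArg (proj 𝒯).map (F.map_add (f := f) (g := g))

variable {F : A ⥤ B} {G : B ⥤ A} [F.Additive] [G.Additive]
  (hF : ∀ X, 𝒮 X → 𝒯 (F.obj X)) (hG : ∀ X, 𝒯 X → 𝒮 (G.obj X))

/-- The adjunction between ideal quotients induced by an adjunction of additive functors. -/
abbrev quotientAdjunction (adj : F ⊣ G) : quotientFunctor F hF ⊣ quotientFunctor G hG where
  unit := CategoryTheory.Quotient.natTransLift _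
    { app := fun X => (proj 𝒮).map (adj.unit.app X)
      naturality := fun X Y f => congrArg (proj 𝒮).map (adj.unit.naturality f) }
  counit := CategoryTheory.Quotient.natTransLift _
    { app := fun X => (proj 𝒯).map (adj.counit.app X)
      naturality := fun X Y f => congrArg (proj 𝒯).map (adj.counit.naturality f) }
  left_triangle_components := by
    rintro ⟨X⟩
    exact (((proj 𝒯).map_comp _ _).symm.trans
      (congrArg (proj 𝒯).map (adj.left_triangle_components X))).trans ((proj 𝒯).map_id _)
  right_triangle_components := by
    rintro ⟨X⟩
    exact (((proj 𝒮).map_comp _ _).symm.trans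
      (congrArg (proj 𝒮).map (adj.right_triangle_components X))).trans ((proj 𝒮).map_id _)

-- Full faithfulness of a left adjoint means that the unit is invertible, and the induced unit is
-- the projection of the original one.
include hG in
theorem quotientFunctor_full_faithful_left (adj : F ⊣ G) [F.Full] [F.Faithful] :
    (quotientFunctor F hF).Full ∧ (quotientFunctor F hF).Faithful := by
  have (X : IdealQuotient 𝒮) : IsIso ((quotientAdjunction hF hG adj).unit.app X) :=
    inferInstanceAs (IsIso ((proj 𝒮).map (adj.unit.app X.as)))
  have : IsIso (quotientAdjunction hF hG adj).unit := NatIso.isIso_of_isIso_app _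
  have h := (quotientAdjunction hF hG adj).fullyFaithfulLOfIsIsoUnit
  exact ⟨h.full, h.faithful⟩

include hF in
theorem quotientFunctor_full_faithful_right (adj : F ⊣ G) [G.Full] [G.Faithful] :
    (quotientFunctor G hG).Full ∧ (quotientFunctor G hG).Faithful := by
  have (X : IdealQuotient 𝒯) : IsIso ((quotientAdjunction hF hG adj).counit.app X) :=
    inferInstanceAs (IsIso ((proj 𝒯).map (adj.counit.app X.as)))
  have : IsIso (quotientAdjunction hF hG adj).counit := NatIso.isIso_of_isIso_app _
  have h := (quotientAdjunction hF hG adj).fullyFaithfulROfIsIsoCounit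
  exact ⟨h.full, h.faithful⟩

end QuotientFunctor

/-! ### Vanishing of extensions across adjunctions. -/

open ExtriangulatedStructure

section Functors

variable {A : Type u₁} [Category.{v₁} A] [Preadditive A] [HasZeroObject A] [HasBinaryBiproducts A]
  {B : Type u₂} [Category.{v₂} B] [Preadditive B] [HasZeroObject B] [HasBinaryBiproducts B]
  {S : ExtriangulatedStructure.{w₁} A} {S' : ExtriangulatedStructure.{w₂} B}

/-- The functor `F` sends conflations to conflations. -/
def PreservesConflations (S : ExtriangulatedStructure.{w₁} A) (S' : ExtriangulatedStructure.{w₂} B)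
    (F : A ⥤ B) : Prop :=
  ∀ ⦃X Y Z : A⦄ (x : X ⟶ Y) (y : Y ⟶ Z), S.IsConflation x y →
    S'.IsConflation (F.map x) (F.map y)

theorem IsExactFunctor.preservesConflations {F : A ⥤ B} (hF : IsExactFunctor S S' F) :
    PreservesConflations S S' F := by
  obtain ⟨η, -, -, h⟩ := hF.exists_nat
  rintro X Y Z x y ⟨δ, hδ⟩
  exact ⟨_, h x y δ hδ⟩

theorem ExtriangulatedStructure.Realizes.eq_zero_of_section {X Y Z : A} {x : X ⟶ Y} {y : Y ⟶ Z}
    {δ : Ext S.E Z X} (h : S.Realizes x y δ) (s : Z ⟶ Y) (hs : s ≫ y = 𝟙 Z) : δ = 0 := by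
  rw [← pull_id S.E δ, ← hs, pull_comp, h.pull_eq_zero, pull_map_zero]

theorem ExtriangulatedStructure.Realizes.eq_zero_of_retraction {X Y Z : A} {x : X ⟶ Y} {y : Y ⟶ Z}
    {δ : Ext S.E Z X} (h : S.Realizes x y δ) (r : Y ⟶ X) (hr : x ≫ r = 𝟙 X) : δ = 0 := by
  rw [← push_id S.E δ, ← hr, push_comp, h.push_eq_zero, push_map_zero]

/-- If `F ⊣ G` and `G` preserves conflations, then vanishing of `𝔼(X, G Y)` implies vanishing of
`𝔼(F X, Y)`. -/
theorem ext_eq_zero_of_right_adjoint {F : A ⥤ B} {G : B ⥤ A} (adj : F ⊣ G)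
    (hG : PreservesConflations S' S G) {X : A} {Y : B}
    (h : ∀ ε : Ext S.E X (G.obj Y), ε = 0) (δ : Ext S'.E (F.obj X) Y) : δ = 0 := by
  obtain ⟨W, x, y, hδ⟩ := S'.exists_realizes δ
  obtain ⟨ε, hε⟩ := hG x y ⟨δ, hδ⟩
  -- The obstruction to lifting the unit to `G W` lies in `𝔼(X, G Y) = 0`; the transpose of the lift
  -- is a section of `y`.
  obtain ⟨t, ht⟩ := hε.exists_lift (adj.unit.app X) (h _)
  refine hδ.eq_zero_of_section (F.map t ≫ adj.counit.app W) ?_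
  rw [Category.assoc, ← adj.counit_naturality, ← F.map_comp_assoc, ht]
  simp

/-- If `F ⊣ G` and `F` preserves conflations, then vanishing of `𝔼(F X, Y)` implies vanishing of
`𝔼(X, G Y)`. -/
theorem ext_eq_zero_of_left_adjoint {F : A ⥤ B} {G : B ⥤ A} (adj : F ⊣ G)
    (hF : PreservesConflations S S' F) {X : A} {Y : B}
    (h : ∀ ε : Ext S'.E (F.obj X) Y, ε = 0) (δ : Ext S.E X (G.obj Y)) : δ = 0 := by
  obtain ⟨W, x, y, hδ⟩ := S.exists_realizes δ
  obtain ⟨ε, hε⟩ := hF x y ⟨δ, hδ⟩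
  obtain ⟨t, ht⟩ := hε.exists_extension (adj.counit.app Y) (h _)
  refine hδ.eq_zero_of_retraction (adj.unit.app W ≫ G.map t) ?_
  rw [← adj.unit_naturality_assoc, ← G.map_comp, ht]
  simp

end Functors

/-! ### Consequences of exactness of `i^*` and `i^!` in a recollement. -/

namespace Recollement

variable {A : Type u₁} [Category.{v₁} A] [Preadditive A] [HasZeroObject A] [HasBinaryBiproducts A]
  {B : Type u₂} [Category.{v₂} B] [Preadditive B] [HasZeroObject B] [HasBinaryBiproducts B]
  {C : Type u₃} [Category.{v₃} C] [Preadditive C] [HasZeroObject C] [HasBinaryBiproducts C]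
  {SA : ExtriangulatedStructure.{w₁} A} {SB : ExtriangulatedStructure.{w₂} B}
  {SC : ExtriangulatedStructure.{w₃} C} (R : Recollement SA SB SC)

instance : R.iLowerStar.Full := R.iLowerStar_full
instance : R.iLowerStar.Faithful := R.iLowerStar_faithful
instance : R.jLowerShriek.Full := R.jLowerShriek_full
instance : R.jLowerShriek.Faithful := R.jLowerShriek_faithful
instance : R.jLowerStar.Full := R.jLowerStar_full
instance : R.jLowerStar.Faithful := R.jLowerStar_faithful
instance : R.iLowerStar.Additive := R.iLowerStar_exact.additive
instance : R.jUpperStar.Additive := R.jUpperStar_exact.additive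
instance : R.iUpperStar.Additive := R.iUpperStar_rightExact.additive
instance : R.jLowerShriek.Additive := R.jLowerShriek_rightExact.additive
instance : R.iUpperShriek.Additive := R.iUpperShriek_leftExact.additive
instance : R.jLowerStar.Additive := R.jLowerStar_leftExact.additive

theorem isZero_jUpperStar_iLowerStar (X : A) :
    IsZero (R.jUpperStar.obj (R.iLowerStar.obj X)) :=
  (R.essImage_iff _).1 (R.iLowerStar.obj_mem_essImage X)

/-- Transposed across both adjunctions, the identity becomes a morphism out of an object `j^* i_*
(-)`, which is zero. -/
theorem isZero_iUpperShriek_jLowerStar (X : C) :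
    IsZero (R.iUpperShriek.obj (R.jLowerStar.obj X)) := by
  rw [IsZero.iff_id_eq_zero]
  apply (R.adjShriekI.homEquiv _ _).symm.injective
  apply (R.adjStarJ.homEquiv _ _).symm.injective
  exact (R.isZero_jUpperStar_iLowerStar _).eq_of_src _ _

theorem isZero_iUpperStar_jLowerShriek (X : C) :
    IsZero (R.iUpperStar.obj (R.jLowerShriek.obj X)) := by
  rw [IsZero.iff_id_eq_zero]
  apply (R.adjStarI.homEquiv _ _).injective
  apply (R.adjShriekJ.homEquiv _ _).injective
  exact (R.isZero_jUpperStar_iLowerStar _).eq_of_tgt _ _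

instance (X : B) : IsIso (R.iUpperShriek.map (R.adjShriekI.counit.app X)) := by
  have := R.adjShriekI.right_triangle_components X
  rw [← IsIso.eq_inv_comp] at this
  rw [this]
  infer_instance

instance (X : B) : IsIso (R.iUpperStar.map (R.adjStarI.unit.app X)) := by
  have := R.adjStarI.left_triangle_components X
  rw [← IsIso.eq_comp_inv, Category.id_comp] at this
  rw [this]
  infer_instance

/-- If `i^!` is exact, then `i_* i^! X ⟶ X ⟶ j_* j^* X` is a conflation. -/
theorem isConflation_counitI_unitJ (hi : PreservesConflations SB SA R.iUpperShriek) (X : B) :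
    SB.IsConflation (R.adjShriekI.counit.app X) (R.adjStarJ.unit.app X) := by
  obtain ⟨A₀, p, K, g₁, g₂, h₁, h₂, hg, -⟩ := R.exists_leftExactFour X
  -- Apply `i^!` to both halves of (R4). The first inflation becomes invertible, so `i^! K = 0`; as
  -- `i^! j_* = 0`, the second half then gives `A₀ ≅ i^! i_* A₀ = 0`, so `g₂` is invertible.
  have hK := (hi _ _ h₁).isZero_right
  have : IsIso (R.iUpperShriek.map g₂) :=
    ⟨0, hK.eq_of_src _ _, (R.isZero_iUpperShriek_jLowerStar _).eq_of_src _ _⟩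
  have hA : IsZero A₀ :=
    (hi _ _ h₂).isZero_right.of_iso (asIso (R.adjShriekI.unit.app A₀))
  have := h₂.isIso_of_isZero_right (R.iLowerStar.map_isZero hA)
  rw [← hg]
  exact h₁.comp_iso (asIso g₂)

/-- If `i^*` is exact, then `j_! j^* X ⟶ X ⟶ i_* i^* X` is a conflation. -/
theorem isConflation_counitJ_unitI (hi : PreservesConflations SB SA R.iUpperStar) (X : B) :
    SB.IsConflation (R.adjShriekJ.counit.app X) (R.adjStarI.unit.app X) := by
  obtain ⟨A₀, p, K, g₁, g₂, h₁, h₂, hg, -⟩ := R.exists_rightExactFour X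
  have hK := (hi _ _ h₂).isZero_left
  have : IsIso (R.iUpperStar.map g₁) :=
    ⟨0, (R.isZero_iUpperStar_jLowerShriek _).eq_of_src _ _, hK.eq_of_src _ _⟩
  have hA : IsZero A₀ :=
    (hi _ _ h₁).isZero_left.of_iso (asIso (R.adjStarI.counit.app A₀)).symm
  have := h₁.isIso_of_isZero_left (R.iLowerStar.map_isZero hA)
  rw [← hg]
  exact h₂.iso_comp (asIso g₁)

/-- If `i^!` is exact, then `j_*` preserves conflations. -/
theorem preservesConflations_jLowerStar (hi : PreservesConflations SB SA R.iUpperShriek) :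
    PreservesConflations SC SB R.jLowerStar := by
  rintro X W Z f g ⟨δ, hδ⟩
  obtain ⟨c⟩ := R.jLowerStar_leftExact.exists_comparison
  -- Left exactness only gives a third term `K` in place of `j_* Z`. Since `i^! K = 0`, the unit `K
  -- ⟶ j_* j^* K` is invertible, and it remains to identify `j^* K` with `Z`.
  obtain ⟨y, -, hy⟩ := c.realizes f g δ hδ
  generalize c.obj δ = K, c.η δ = ε₀ at y hy
  have hy' : SB.IsConflation (R.jLowerStar.map f) y := ⟨_, hy⟩
  have : IsIso (R.iUpperShriek.map (R.jLowerStar.map f)) :=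
    ⟨0, (R.isZero_iUpperShriek_jLowerStar _).eq_of_src _ _,
      (R.isZero_iUpperShriek_jLowerStar _).eq_of_src _ _⟩
  have hK := (hi _ _ hy').isZero_right
  have := (R.isConflation_counitI_unitJ hi K).isIso_of_isZero_left (R.iLowerStar.map_isZero hK)
  -- The image of this conflation under `j^*` is compared with the given one.
  have hj := (R.jUpperStar_exact.preservesConflations _ _ hy').iso_comp
    (asIso (R.adjStarJ.counit.app X)).symm
  have hj' := hj.middle_iso (asIso (R.adjStarJ.counit.app W))
  have hf : ((asIso (R.adjStarJ.counit.app X)).symm.hom ≫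
      R.jUpperStar.map (R.jLowerStar.map f)) ≫ (asIso (R.adjStarJ.counit.app W)).hom = f := by
    simp
  rw [hf] at hj'
  obtain ⟨ε, hε⟩ := hj'
  obtain ⟨θ, hθ, hδε⟩ := SC.et3 hε hδ (𝟙 X) (𝟙 W) (by simp)
  have hθ' : ((asIso (R.adjStarJ.counit.app W)).inv ≫ R.jUpperStar.map y) ≫ θ = g := by
    simpa using hθ
  have := hε.isIso_right hδ θ hθ' (by simpa using hδε)
  have hfinal := hy'.comp_iso (asIso (R.adjStarJ.unit.app K) ≪≫ R.jLowerStar.mapIso (asIso θ))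
  convert hfinal using 1
  rw [← hθ']
  simp

end Recollement

/-! ### Cluster tilting subcategories along the recollement. -/

namespace Recollement

open ExtriangulatedStructure

variable {A : Type u₁} [Category.{v₁} A] [Preadditive A] [HasZeroObject A] [HasBinaryBiproducts A]
  {B : Type u₂} [Category.{v₂} B] [Preadditive B] [HasZeroObject B] [HasBinaryBiproducts B]
  {C : Type u₃} [Category.{v₃} C] [Preadditive C] [HasZeroObject C] [HasBinaryBiproducts C]
  {SA : ExtriangulatedStructure.{w₁} A} {SB : ExtriangulatedStructure.{w₂} B}
  {SC : ExtriangulatedStructure.{w₃} C} (R : Recollement SA SB SC)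
  {𝒯 : ObjectProperty B} (h𝒯 : SB.IsClusterTilting 𝒯)

include h𝒯

section ClosedUnderI

variable (hi : ∀ T : B, 𝒯 T → 𝒯 (R.iLowerStar.obj (R.iUpperStar.obj T)))

include hi

/-- Closure of `𝒯` under `i_* i^*` makes the image `i^*𝒯` also the preimage of `𝒯` under `i_*`. -/
theorem map_iUpperStar_iff (X : A) : 𝒯.map R.iUpperStar X ↔ 𝒯 (R.iLowerStar.obj X) := by
  have := h𝒯.closedUnderIso
  constructor
  · rintro ⟨T, hT, ⟨e⟩⟩
    exact 𝒯.prop_of_iso (R.iLowerStar.mapIso e) (hi T hT)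
  · exact fun h => ⟨_, h, ⟨asIso (R.adjStarI.counit.app X)⟩⟩

/-- Two adjunctions reduce the vanishing of `𝔼(T', i_* i^! T)` to that of `𝔼(i^* T', i^! T)` and
then of `𝔼(i_* i^* T', T)`, where both arguments lie in `𝒯`. -/
theorem map_iUpperStar_iUpperShriek (hS : PreservesConflations SB SA R.iUpperStar)
    {T : B} (hT : 𝒯 T) : 𝒯.map R.iUpperStar (R.iUpperShriek.obj T) := by
  rw [R.map_iUpperStar_iff h𝒯 hi, h𝒯.mem_iff_right]
  intro T' hT' δ
  refine ext_eq_zero_of_left_adjoint R.adjStarI hS (fun ε => ?_) δ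
  refine ext_eq_zero_of_left_adjoint R.adjShriekI
    R.iLowerStar_exact.preservesConflations (fun ε => ?_) ε
  exact h𝒯.ext_eq_zero (hi T' hT') hT ε

/-- `i^* 𝒯` is cluster tilting. -/
theorem isClusterTilting_map_iUpperStar (hS : PreservesConflations SB SA R.iUpperStar)
    (hS' : PreservesConflations SB SA R.iUpperShriek) :
    SA.IsClusterTilting (𝒯.map R.iUpperStar) := by
  have hE : ∀ X Y : A, 𝒯.map R.iUpperStar X → 𝒯.map R.iUpperStar Y →
      ∀ δ : Ext SA.E X Y, δ = 0 := by
    rintro X Y ⟨T, hT, ⟨e⟩⟩ hY δ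
    rw [R.map_iUpperStar_iff h𝒯 hi] at hY
    have : pull SA.E e.hom δ = 0 := ext_eq_zero_of_right_adjoint R.adjStarI
      R.iLowerStar_exact.preservesConflations (fun ε => h𝒯.ext_eq_zero hT hY ε) _
    rw [← pull_id SA.E δ, ← e.inv_hom_id, pull_comp, this, pull_map_zero]
  refine ⟨inferInstance, fun X => ?_, fun X => ?_, fun X => ⟨fun hX Y hY => hE X Y hX hY, ?_⟩,
    fun X => ⟨fun hX Y hY => hE Y X hY hX, ?_⟩⟩
  · obtain ⟨K, T, k, g, hkg, hT, hg⟩ := h𝒯.contravariantlyFinite (R.iLowerStar.obj X)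
    refine ⟨_, _, _, _, (hS _ _ hkg).comp_iso (asIso (R.adjStarI.counit.app X)),
      𝒯.prop_map_obj _ hT, ?_⟩
    rintro Y ⟨T', hT', ⟨e⟩⟩ h
    obtain ⟨k, hk⟩ := hg T' hT' ((R.adjStarI.homEquiv _ _) (e.hom ≫ h))
    refine ⟨e.inv ≫ R.iUpperStar.map k, ?_⟩
    rw [Category.assoc, Iso.inv_comp_eq, asIso_hom, ← R.iUpperStar.map_comp_assoc, hk]
    exact (R.adjStarI.homEquiv_counit _ _ _).symm.trans (Equiv.symm_apply_apply _ _)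
  -- Apply `i^!` to a left approximation of `i_* X`; a map `X ⟶ Y` extends after applying `i_*`,
  -- because `i_* Y` is in `𝒯`.
  · obtain ⟨T, L, f, l, hfl, hT, hf⟩ := h𝒯.covariantlyFinite (R.iLowerStar.obj X)
    refine ⟨_, _, _, _, (hS' _ _ hfl).iso_comp (asIso (R.adjShriekI.unit.app X)),
      R.map_iUpperStar_iUpperShriek h𝒯 hi hS hT, ?_⟩
    intro Y hY h
    obtain ⟨k, hk⟩ := hf _ ((R.map_iUpperStar_iff h𝒯 hi Y).1 hY) (R.iLowerStar.map h)
    refine ⟨R.iUpperShriek.map k ≫ inv (R.adjShriekI.unit.app Y), ?_⟩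
    rw [← Category.assoc, IsIso.comp_inv_eq, asIso_hom, Category.assoc,
      ← R.iUpperShriek.map_comp, hk]
    simp
  · intro h
    rw [R.map_iUpperStar_iff h𝒯 hi, h𝒯.mem_iff_left]
    intro T hT
    exact ext_eq_zero_of_right_adjoint R.adjShriekI hS'
      (h _ (R.map_iUpperStar_iUpperShriek h𝒯 hi hS hT))
  · intro h
    rw [R.map_iUpperStar_iff h𝒯 hi, h𝒯.mem_iff_right]
    intro T hT
    exact ext_eq_zero_of_left_adjoint R.adjStarI hS (h _ (𝒯.prop_map_obj _ hT))

end ClosedUnderI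

section ClosedUnderJ

variable (hj : ∀ T : B, 𝒯 T → 𝒯 (R.jLowerStar.obj (R.jUpperStar.obj T)))

include hj

theorem map_jUpperStar_iff (X : C) : 𝒯.map R.jUpperStar X ↔ 𝒯 (R.jLowerStar.obj X) := by
  have := h𝒯.closedUnderIso
  constructor
  · rintro ⟨T, hT, ⟨e⟩⟩
    exact 𝒯.prop_of_iso (R.jLowerStar.mapIso e) (hj T hT)
  · exact fun h => ⟨_, h, ⟨asIso (R.adjStarJ.counit.app X)⟩⟩

/-- Since `j_*` preserves conflations, `𝔼(j^* T, Y)` vanishes with `𝔼(T, j_* Y)`. -/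
theorem ext_map_jUpperStar_eq_zero (hS : PreservesConflations SB SA R.iUpperShriek) {X Y : C}
    (hX : 𝒯.map R.jUpperStar X) (hY : 𝒯.map R.jUpperStar Y) (δ : Ext SC.E X Y) : δ = 0 := by
  obtain ⟨T, hT, ⟨e⟩⟩ := hX
  rw [R.map_jUpperStar_iff h𝒯 hj] at hY
  have : pull SC.E e.hom δ = 0 := ext_eq_zero_of_right_adjoint R.adjStarJ
    (R.preservesConflations_jLowerStar hS) (fun ε => h𝒯.ext_eq_zero hT hY ε) _
  rw [← pull_id SC.E δ, ← e.inv_hom_id, pull_comp, this, pull_map_zero]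

/-- The vanishing of `𝔼(j_! X, T)` follows from that of `𝔼(X, j^* T)`, so closure of `𝒯` under `j_!
j^*` need not be assumed. -/
theorem jLowerShriek_mem (hS : PreservesConflations SB SA R.iUpperShriek) {X : C}
    (hX : 𝒯.map R.jUpperStar X) : 𝒯 (R.jLowerShriek.obj X) := by
  rw [h𝒯.mem_iff_left]
  intro T hT
  exact ext_eq_zero_of_right_adjoint R.adjShriekJ R.jUpperStar_exact.preservesConflations
    (R.ext_map_jUpperStar_eq_zero h𝒯 hj hS hX (𝒯.prop_map_obj _ hT))

/-- `j^* 𝒯` is cluster tilting. -/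
theorem isClusterTilting_map_jUpperStar (hS : PreservesConflations SB SA R.iUpperShriek) :
    SC.IsClusterTilting (𝒯.map R.jUpperStar) := by
  have hJ := R.jUpperStar_exact.preservesConflations
  refine ⟨inferInstance, fun X => ?_, fun X => ?_,
    fun X => ⟨fun hX Y hY => R.ext_map_jUpperStar_eq_zero h𝒯 hj hS hX hY, ?_⟩,
    fun X => ⟨fun hX Y hY => R.ext_map_jUpperStar_eq_zero h𝒯 hj hS hY hX, ?_⟩⟩
  · obtain ⟨K, T, k, g, hkg, hT, hg⟩ := h𝒯.contravariantlyFinite (R.jLowerStar.obj X)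
    refine ⟨_, _, _, _, (hJ _ _ hkg).comp_iso (asIso (R.adjStarJ.counit.app X)),
      𝒯.prop_map_obj _ hT, ?_⟩
    rintro Y ⟨T', hT', ⟨e⟩⟩ h
    obtain ⟨k, hk⟩ := hg T' hT' ((R.adjStarJ.homEquiv _ _) (e.hom ≫ h))
    refine ⟨e.inv ≫ R.jUpperStar.map k, ?_⟩
    rw [Category.assoc, Iso.inv_comp_eq, asIso_hom, ← R.jUpperStar.map_comp_assoc, hk]
    exact (R.adjStarJ.homEquiv_counit _ _ _).symm.trans (Equiv.symm_apply_apply _ _)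
  -- Left approximations come from `j_! X`, right ones from `j_* X`: in each case `j^*` recovers `X`
  -- and the adjunction transposes the test maps.
  · obtain ⟨T, L, f, l, hfl, hT, hf⟩ := h𝒯.covariantlyFinite (R.jLowerShriek.obj X)
    refine ⟨_, _, _, _, (hJ _ _ hfl).iso_comp (asIso (R.adjShriekJ.unit.app X)),
      𝒯.prop_map_obj _ hT, ?_⟩
    rintro Y ⟨T', hT', ⟨e⟩⟩ h
    obtain ⟨k, hk⟩ := hf T' hT' ((R.adjShriekJ.homEquiv _ _).symm (h ≫ e.inv))
    refine ⟨R.jUpperStar.map k ≫ e.hom, ?_⟩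
    rw [← Category.assoc, ← Iso.eq_comp_inv, asIso_hom, Category.assoc, ← R.jUpperStar.map_comp,
      hk]
    exact (R.adjShriekJ.homEquiv_unit _ _ _).symm.trans (Equiv.apply_symm_apply _ _)
  · intro h
    have : 𝒯 (R.jLowerShriek.obj X) := by
      rw [h𝒯.mem_iff_left]
      intro T hT
      exact ext_eq_zero_of_right_adjoint R.adjShriekJ hJ (h _ (𝒯.prop_map_obj _ hT))
    exact ⟨_, this, ⟨(asIso (R.adjShriekJ.unit.app X)).symm⟩⟩
  · intro h
    rw [R.map_jUpperStar_iff h𝒯 hj, h𝒯.mem_iff_right]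
    intro T hT
    exact ext_eq_zero_of_left_adjoint R.adjStarJ hJ (h _ (𝒯.prop_map_obj _ hT))

/-- The first term `j_! j^* X` of the conflation ending in this unit lies in `𝒯`, so `𝔼(𝒯, -)` is
injective on the unit. -/
theorem mono_proj_map_unit (hS : PreservesConflations SB SA R.iUpperStar)
    (hS' : PreservesConflations SB SA R.iUpperShriek) {X : B}
    (hX : 𝒯.map R.jUpperStar (R.jUpperStar.obj X)) :
    Mono ((proj 𝒯).map (R.adjStarI.unit.app X)) := by
  refine h𝒯.mono_proj_map_of_push fun T hT ε hε => ?_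
  obtain ⟨δ, hδ⟩ := R.isConflation_counitJ_unitI hS X
  obtain ⟨ε', rfl⟩ := hδ.exists_push_left_eq ε hε
  rw [h𝒯.ext_eq_zero hT (R.jLowerShriek_mem h𝒯 hj hS' hX) ε', push_map_zero]

/-- The third term `j_* j^* X` of the conflation starting with this counit lies in `𝒯`, so `𝔼(-, 𝒯)`
is injective on the counit. -/
theorem epi_proj_map_counit (hS : PreservesConflations SB SA R.iUpperShriek) {X : B}
    (hX : 𝒯.map R.jUpperStar (R.jUpperStar.obj X)) :
    Epi ((proj 𝒯).map (R.adjShriekI.counit.app X)) := by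
  refine h𝒯.epi_proj_map_of_pull fun T hT ε hε => ?_
  obtain ⟨δ, hδ⟩ := R.isConflation_counitI_unitJ hS X
  obtain ⟨ε', rfl⟩ := hδ.exists_pull_right_eq ε hε
  rw [h𝒯.ext_eq_zero ((R.map_jUpperStar_iff h𝒯 hj _).1 hX) hT ε', pull_map_zero]

end ClosedUnderJ

/-- The unit `X ⟶ i_* i^* X` becomes invertible modulo `[𝒯]` if `j^* X` lies in `j^* 𝒯`. -/
theorem isIso_proj_map_unit (hi : ∀ T : B, 𝒯 T → 𝒯 (R.iLowerStar.obj (R.iUpperStar.obj T)))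
    (hj : ∀ T : B, 𝒯 T → 𝒯 (R.jLowerStar.obj (R.jUpperStar.obj T)))
    (hS : PreservesConflations SB SA R.iUpperStar)
    (hS' : PreservesConflations SB SA R.iUpperShriek) {X : B}
    (hX : 𝒯.map R.jUpperStar (R.jUpperStar.obj X)) :
    IsIso ((proj 𝒯).map (R.adjStarI.unit.app X)) := by
  have := R.mono_proj_map_unit h𝒯 hj hS hS' hX
  have he := R.epi_proj_map_counit h𝒯 hj hS' hX
  have h₁ : ∀ T, 𝒯 T → 𝒯.map R.iUpperStar (R.iUpperStar.obj T) :=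
    fun T hT => 𝒯.prop_map_obj _ hT
  have h₂ : ∀ X, 𝒯.map R.iUpperStar X → 𝒯 (R.iLowerStar.obj X) :=
    fun X => (R.map_iUpperStar_iff h𝒯 hi X).1
  have h₃ : ∀ T, 𝒯 T → 𝒯.map R.iUpperStar (R.iUpperShriek.obj T) :=
    fun T hT => R.map_iUpperStar_iUpperShriek h𝒯 hi hS hT
  let F := quotientFunctor R.iUpperStar h₁
  let G := quotientFunctor R.iLowerStar h₂
  -- On the quotients `i^*` and `i_*` are both left adjoints, so `i_* i^*` keeps the counit epic.
  have hF : F.PreservesEpimorphisms :=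
    Functor.preservesEpimorphisms_of_adjunction (quotientAdjunction h₁ h₂ R.adjStarI)
  have hG : G.PreservesEpimorphisms :=
    Functor.preservesEpimorphisms_of_adjunction (quotientAdjunction h₂ h₃ R.adjShriekI)
  have hGF : Epi (G.map (F.map ((proj 𝒯).map (R.adjShriekI.counit.app X)))) := inferInstance
  have hGF' : Epi ((proj 𝒯).map (R.iLowerStar.map (R.iUpperStar.map
    (R.adjShriekI.counit.app X)))) := hGF
  have : Epi ((proj 𝒯).map (R.adjStarI.unit.app X)) := by
    have : Epi ((proj 𝒯).map (R.adjShriekI.counit.app X) ≫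
        (proj 𝒯).map (R.adjStarI.unit.app X)) := by
      -- By naturality the composite is the unit at an object of the image of `i_*`, which is
      -- invertible, followed by an epi.
      have e : R.adjShriekI.counit.app X ≫ R.adjStarI.unit.app X =
          R.adjStarI.unit.app (R.iLowerStar.obj (R.iUpperShriek.obj X)) ≫ R.iLowerStar.map (R.iUpperStar.map (R.adjShriekI.counit.app X)) :=
        (R.adjStarI.unit_naturality _).symm
      rw [← Functor.map_comp, e, Functor.map_comp]
      exact epi_comp _ _
    exact epi_of_epi ((proj 𝒯).map (R.adjShriekI.counit.app X)) _
  have := h𝒯.isNormalEpiCategory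
  have : Balanced (IdealQuotient 𝒯) := balanced_of_strongEpiCategory
  exact isIso_of_mono_of_epi _

end Recollement

end Extri

/-! ### The induced recollement. -/

theorem theorem4p5
    {A : Type u₁} [Category.{v₁} A] [Preadditive A] [HasZeroObject A] [HasBinaryBiproducts A]
    {B : Type u₂} [Category.{v₂} B] [Preadditive B] [HasZeroObject B] [HasBinaryBiproducts B]
    {C : Type u₃} [Category.{v₃} C] [Preadditive C] [HasZeroObject C] [HasBinaryBiproducts C]
    (SA : Extri.ExtriangulatedStructure.{w₁} A) (SB : Extri.ExtriangulatedStructure.{w₂} B)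
    (SC : Extri.ExtriangulatedStructure.{w₃} C)
    (hB : SB.HasEnoughProjectives)
    (R : Extri.Recollement SA SB SC)
    (hiUpperStar : Extri.IsExactFunctor SB SA R.iUpperStar)
    (hiUpperShriek : Extri.IsExactFunctor SB SA R.iUpperShriek)
    (𝒯 : ObjectProperty B) (h𝒯 : SB.IsClusterTilting 𝒯)
    (hj : ∀ T : B, 𝒯 T → 𝒯 (R.jLowerStar.obj (R.jUpperStar.obj T)))
    (hi : ∀ T : B, 𝒯 T → 𝒯 (R.iLowerStar.obj (R.iUpperStar.obj T))) :
    ∃ Q : Extri.AbelianRecollement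
        (Extri.IdealQuotient (𝒯.map R.iUpperStar))
        (Extri.IdealQuotient 𝒯)
        (Extri.IdealQuotient (𝒯.map R.jUpperStar)),
      Extri.proj 𝒯 ⋙ Q.iUpperStar = R.iUpperStar ⋙ Extri.proj (𝒯.map R.iUpperStar) ∧
      Extri.proj (𝒯.map R.iUpperStar) ⋙ Q.iLowerStar = R.iLowerStar ⋙ Extri.proj 𝒯 ∧
      Extri.proj 𝒯 ⋙ Q.iUpperShriek = R.iUpperShriek ⋙ Extri.proj (𝒯.map R.iUpperStar) ∧
      Extri.proj (𝒯.map R.jUpperStar) ⋙ Q.jLowerShriek = R.jLowerShriek ⋙ Extri.proj 𝒯 ∧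
      Extri.proj 𝒯 ⋙ Q.jUpperStar = R.jUpperStar ⋙ Extri.proj (𝒯.map R.jUpperStar) ∧
      Extri.proj (𝒯.map R.jUpperStar) ⋙ Q.jLowerStar = R.jLowerStar ⋙ Extri.proj 𝒯 := by
  have hS := hiUpperStar.preservesConflations
  have hS' := hiUpperShriek.preservesConflations
  have hA := R.isClusterTilting_map_iUpperStar h𝒯 hi hS hS'
  have hC := R.isClusterTilting_map_jUpperStar h𝒯 hj hS'
  have h₁ : ∀ T, 𝒯 T → 𝒯.map R.iUpperStar (R.iUpperStar.obj T) :=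
    fun T hT => 𝒯.prop_map_obj _ hT
  have h₂ : ∀ X, 𝒯.map R.iUpperStar X → 𝒯 (R.iLowerStar.obj X) :=
    fun X => (R.map_iUpperStar_iff h𝒯 hi X).1
  have h₃ : ∀ T, 𝒯 T → 𝒯.map R.iUpperStar (R.iUpperShriek.obj T) :=
    fun T hT => R.map_iUpperStar_iUpperShriek h𝒯 hi hS hT
  have h₄ : ∀ X, 𝒯.map R.jUpperStar X → 𝒯 (R.jLowerShriek.obj X) :=
    fun X => R.jLowerShriek_mem h𝒯 hj hS'
  have h₅ : ∀ T, 𝒯 T → 𝒯.map R.jUpperStar (R.jUpperStar.obj T) :=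
    fun T hT => 𝒯.prop_map_obj _ hT
  have h₆ : ∀ X, 𝒯.map R.jUpperStar X → 𝒯 (R.jLowerStar.obj X) :=
    fun X => (R.map_jUpperStar_iff h𝒯 hj X).1
  have hI := Extri.quotientFunctor_full_faithful_right h₁ h₂ R.adjStarI
  have hJ := Extri.quotientFunctor_full_faithful_left h₄ h₅ R.adjShriekJ
  have hJ' := Extri.quotientFunctor_full_faithful_right h₅ h₆ R.adjStarJ
  refine ⟨{
    abelianA := hA.isAbelianCategory
    abelianB := h𝒯.isAbelianCategory
    abelianC := hC.isAbelianCategory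
    iUpperStar := Extri.quotientFunctor R.iUpperStar h₁
    iLowerStar := Extri.quotientFunctor R.iLowerStar h₂
    iUpperShriek := Extri.quotientFunctor R.iUpperShriek h₃
    jLowerShriek := Extri.quotientFunctor R.jLowerShriek h₄
    jUpperStar := Extri.quotientFunctor R.jUpperStar h₅
    jLowerStar := Extri.quotientFunctor R.jLowerStar h₆
    iUpperStar_additive := Extri.quotientFunctor_additive R.iUpperStar h₁
    iLowerStar_additive := Extri.quotientFunctor_additive R.iLowerStar h₂
    iUpperShriek_additive := Extri.quotientFunctor_additive R.iUpperShriek h₃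
    jLowerShriek_additive := Extri.quotientFunctor_additive R.jLowerShriek h₄
    jUpperStar_additive := Extri.quotientFunctor_additive R.jUpperStar h₅
    jLowerStar_additive := Extri.quotientFunctor_additive R.jLowerStar h₆
    adjStarI := Extri.quotientAdjunction h₁ h₂ R.adjStarI
    adjShriekI := Extri.quotientAdjunction h₂ h₃ R.adjShriekI
    adjShriekJ := Extri.quotientAdjunction h₄ h₅ R.adjShriekJ
    adjStarJ := Extri.quotientAdjunction h₅ h₆ R.adjStarJ
    iLowerStar_full := hI.1
    iLowerStar_faithful := hI.2
    jLowerShriek_full := hJ.1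
    jLowerShriek_faithful := hJ.2
    jLowerStar_full := hJ'.1
    jLowerStar_faithful := hJ'.2
    essImage_iff := ?_ }, Extri.proj_comp_quotientFunctor _ h₁, Extri.proj_comp_quotientFunctor _ h₂,
    Extri.proj_comp_quotientFunctor _ h₃, Extri.proj_comp_quotientFunctor _ h₄,
    Extri.proj_comp_quotientFunctor _ h₅, Extri.proj_comp_quotientFunctor _ h₆⟩
  intro X
  constructor
  · rintro ⟨Y, ⟨e⟩⟩
    have hY : IsZero ((Extri.proj (𝒯.map R.jUpperStar)).obj
        (R.jUpperStar.obj (R.iLowerStar.obj Y.as))) :=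
      Functor.map_isZero _ (R.isZero_jUpperStar_iLowerStar Y.as)
    exact IsZero.of_iso hY ((Extri.quotientFunctor R.jUpperStar h₅).mapIso e.symm)
  · intro hX
    -- Vanishing of the induced `j^*` on `X` means that `j^* X` lies in `j^*𝒯`, so the unit exhibits
    -- `X` as `i_* i^* X` in the quotient.
    have hX' := (hC.isZero_proj_obj_iff (R.jUpperStar.obj X.as)).1 hX
    have := R.isIso_proj_map_unit h𝒯 hi hj hS hS' hX'
    exact ⟨(Extri.proj _).obj (R.iUpperStar.obj X.as),
      ⟨(asIso ((Extri.proj 𝒯).map (R.adjStarI.unit.app X.as))).symm⟩⟩
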